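/- **Conventions.** A symmetric monoidal bicategory $(\mathcal C,\otimes,1)$ is a bicategory with a pseudofunctor $\otimes$, a unit object $1$, natural adjoint equivalences $\alpha_{abc}:(a\otimes b)\otimes c\to a\otimes(b\otimes c)$, $\lambda_a:1\otimes a\to a$, $\rho_a:a\to a\otimes 1$, $\beta_{ab}:a\otimes b\to b\otimes a$, and invertible modifications (pentagon, three unit modifications, two hexagons, syllepsis) satisfying the usual coherence axioms. A symmetric monoidal 2-functor $\mathcal H:\mathcal C\to\mathcal D$ is a pseudofunctor, with invertible composition and unit constraints $\Phi_{\mathcal H}:\mathcal H(g)\circ\mathcal H(f)\Rightarrow\mathcal H(g\circ f)$ and $\Phi_{\mathcal H}:\mathrm{id}_{\mathcal H(a)}\Rightarrow\mathcal H(\mathrm{id}_a)$, together with adjoint equivalences $\chi_{\mathcal H}:\mathcal H(a)\otimes\mathcal H(b)\to\mathcal H(a\otimes b)$ (natural in $a,b$) and $\iota_{\mathcal H}:1\to\mathcal H(1)$, and invertible modifications $\Omega_{\mathcal H}:\mathcal H(\alpha)\circ\chi\circ(\chi\otimes\mathrm{id})\Rightarrow\chi\circ(\mathrm{id}\otimes\chi)\circ\alpha$,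 $\Gamma_{\mathcal H}:\mathcal H(\lambda)\circ\chi\circ(\iota\otimes\mathrm{id})\Rightarrow\lambda$, $\Delta_{\mathcal H}:\mathcal H(\rho)\Rightarrow\chi\circ(\mathrm{id}\otimes\iota)\circ\rho$, $\Upsilon_{\mathcal H}:\mathcal H(\beta)\circ\chi\Rightarrow\chi\circ\beta$, satisfying the usual coherence axioms. The truncation $\mathrm{tr}\,\mathcal C$ has the objects and 1-morphisms of $\mathcal C$ and only its invertible 2-morphisms, and $\mathrm{tr}\,\mathcal H$ is the restriction of $\mathcal H$ to it. A natural symmetric monoidal 2-transformation $\theta:\mathrm{tr}\,\mathcal H\Rightarrow\mathrm{tr}\,\mathcal K$ consists of 1-morphisms $\theta_a:\mathcal H(a)\to\mathcal K(a)$ and of 2-morphisms $\theta_f:\mathcal K(f)\circ\theta_a\Rightarrow\theta_b\circ\mathcal H(f)$ for $f:a\to b$, **not** required to be invertible, which are natural in the invertible 2-morphisms of $\mathcal C$ and compatible with composition and identities, and of invertible modifications $\Pi_{ab}:\chi_{\mathcal K}\circ(\theta_a\otimes\theta_b)\Rightarrow\theta_{a\otimes b}\circ\chi_{\mathcal H}$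 and $M:\iota_{\mathcal K}\Rightarrow\theta_1\circ\iota_{\mathcal H}$, compatible with $\Omega,\Gamma,\Delta,\Upsilon$. The trivial theory $\mathbf 1:\mathcal C\to\mathcal D$ sends every object to the unit $1$ of $\mathcal D$, every 1-morphism to $\mathrm{id}_1$, and every 2-morphism to the identity. **Proposition.** Let $\mathcal C$ and $\mathcal D$ be symmetric monoidal bicategories (for instance a geometric cobordism bicategory with its disjoint union, and the bicategory of complex 2-vector spaces), let $\mathcal A:\mathcal C\to\mathcal D$ be a symmetric monoidal 2-functor (for instance an invertible extended quantum field theory), equip the trivial theory $\mathbf 1:\mathcal C\to\mathcal D$ with any structure of symmetric monoidal 2-functor, and let $A:\mathbf 1\Rightarrow\mathrm{tr}\,\mathcal A$ be a natural symmetric monoidal 2-transformation. For $f:a\to b$ write $A(f):\mathcal A(f)\circ A(a)\Rightarrow A(b)$ for the naturality 2-morphism of $A$ at $f$, after the identification $A(b)\circ\mathrm{id}_1\cong A(b)$. Write $\bullet$ for horizontal composition, and $\circ$ also for vertical composition of 2-morphisms. Up to the coherence isomorphisms of $\mathcal D$, the following hold. 1. (Projective composition law.) $A(g)\circ(\mathrm{id}_{\mathcal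 A(g)}\bullet A(f))=A(g\circ f)\circ(\Phi_{\mathcal A}\bullet\mathrm{id}_{A(a)})$ for all $f:a\to b$, $g:b\to c$. 2. (Unit law.) $A(\mathrm{id}_a)\circ(\Phi_{\mathcal A}\bullet\mathrm{id}_{A(a)})=\mathrm{id}_{A(a)}$ for all objects $a$. 3. (Invariance.) $A(f)=A(g)\circ(\mathcal A(\varphi)\bullet\mathrm{id}_{A(a)})$ for all 2-isomorphisms $\varphi:f\Rightarrow g$ between 1-morphisms $a\to b$. 4. (Tensor products of 1-morphisms.) For $f:a\to a'$ and $g:b\to b'$, two composites $\mathcal A(f\otimes g)\circ\chi_{\mathcal A}\circ(A(a)\otimes A(b))\Rightarrow A(a'\otimes b')\circ\chi_{\mathbf 1}$ agree: first $\Pi_{ab}$, then $A(f\otimes g)$; and first the naturality of $\chi_{\mathcal A}$ and $A(f)\otimes A(g)$, then $\Pi_{a'b'}$ and the naturality of $\chi_{\mathbf 1}$. 5. (Associators.) For objects $a,b,c$, two composites $\mathcal A(\alpha)\circ\chi_{\mathcal A}\circ(\chi_{\mathcal A}\otimes\mathrm{id})\circ((A(a)\otimes A(b))\otimes A(c))\Rightarrow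 A(a\otimes(b\otimes c))\circ\chi_{\mathbf 1}\circ(\mathrm{id}\otimes\chi_{\mathbf 1})\circ\alpha$ agree: $\Pi_{ab}$, $\Pi_{a\otimes b,c}$, $A(\alpha_{abc})$, $\Omega_{\mathbf 1}$ in this order; and $\Omega_{\mathcal A}$, the naturality of the associator of $\mathcal D$, $\Pi_{bc}$, $\Pi_{a,b\otimes c}$ in this order. 6. (Left unitors.) For every object $a$, two composites $\mathcal A(\lambda_a)\circ\chi_{\mathcal A}\circ(A(1)\otimes A(a))\circ(\iota_{\mathbf 1}\otimes\mathrm{id})\Rightarrow A(a)\circ\lambda_1$ agree: $\Pi_{1,a}$, $A(\lambda_a)$, $\Gamma_{\mathbf 1}$; and $M^{-1}\otimes\mathrm{id}$, $\Gamma_{\mathcal A}$, the naturality of the left unitor of $\mathcal D$. 7. (Right unitors.) For every object $a$, two composites $\mathcal A(\rho_a)\circ A(a)\Rightarrow A(a\otimes 1)\circ\chi_{\mathbf 1}\circ(\mathrm{id}\otimes\iota_{\mathbf 1})\circ\rho_1$ agree: $A(\rho_a)$, $\Delta_{\mathbf 1}$; and $\Delta_{\mathcal A}$, the naturality of the right unitor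 of $\mathcal D$, $\mathrm{id}\otimes M$, $\Pi_{a,1}$. 8. (Braidings.) For objects $a,b$, two composites $\mathcal A(\beta_{ab})\circ\chi_{\mathcal A}\circ(A(a)\otimes A(b))\Rightarrow A(b\otimes a)\circ\chi_{\mathbf 1}\circ\beta_{1,1}$ agree: $\Pi_{ab}$, $A(\beta_{ab})$, $\Upsilon_{\mathbf 1}$; and $\Upsilon_{\mathcal A}$, the naturality of the braiding of $\mathcal D$, $\Pi_{ba}$. -/

import Mathlib

open CategoryTheory Bicategory
open scoped Pseudofunctor.StrongTrans

universe w v u w₁ v₁ u₁ w₂ v₂ u₂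

namespace AnomalousQFT

/-! ### Elementary pseudofunctors -/

section Pseudofunctors

variable {X : Type u} [Bicategory.{w, v} X] {B : Type u₁} [Bicategory.{w₁, v₁} B]
  {C : Type u₂} [Bicategory.{w₂, v₂} C]

/-- First projection. -/
def fstP (B : Type u₁) [Bicategory.{w₁, v₁} B] (C : Type u₂) [Bicategory.{w₂, v₂} C] :
    (B × C) ⥤ᵖ B where
  obj x := x.1
  map f := f.1
  map₂ η := η.1
  mapId _ := Iso.refl _
  mapComp _ _ := Iso.refl _

/-- Second projection. -/
def sndP (B : Type u₁) [Bicategory.{w₁, v₁} B] (C : Type u₂) [Bicategory.{w₂, v₂} C] :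
    (B × C) ⥤ᵖ C where
  obj x := x.2
  map f := f.2
  map₂ η := η.2
  mapId _ := Iso.refl _
  mapComp _ _ := Iso.refl _

/-- The pseudofunctor into a product with prescribed components. -/
def pairP (F : X ⥤ᵖ B) (G : X ⥤ᵖ C) : X ⥤ᵖ (B × C) where
  obj x := (F.obj x, G.obj x)
  map f := (F.map f, G.map f)
  map₂ η := (F.map₂ η, G.map₂ η)
  mapId x := Iso.prod (F.mapId x) (G.mapId x)
  mapComp f g := Iso.prod (F.mapComp f g) (G.mapComp f g)

/-- The constant pseudofunctor: every object goes to `b`, every 1-morphism to `𝟙 b` and every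
2-morphism to the identity 2-morphism. -/
def constP (X : Type u) [Bicategory.{w, v} X] {B : Type u₁} [Bicategory.{w₁, v₁} B] (b : B) :
    X ⥤ᵖ B where
  obj _ := b
  map _ := 𝟙 b
  map₂ _ := 𝟙 (𝟙 b)
  mapId _ := Iso.refl _
  mapComp _ _ := (λ_ (𝟙 b)).symm

end Pseudofunctors

/-! ### Symmetric monoidal bicategories: tensor product, unit, associator, unitors, braiding -/

section TensorPseudofunctors

variable {B : Type u} [Bicategory.{w, v} B] (T : (B × B) ⥤ᵖ B)

/-- `(a, b, c) ↦ (a ⊗ b) ⊗ c`. -/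
def tensorLeft₃ : ((B × B) × B) ⥤ᵖ B :=
  (pairP ((fstP (B × B) B).comp T) (sndP (B × B) B)).comp T

/-- `(a, b, c) ↦ a ⊗ (b ⊗ c)`. -/
def tensorRight₃ : ((B × B) × B) ⥤ᵖ B :=
  (pairP ((fstP (B × B) B).comp (fstP B B))
    ((pairP ((fstP (B × B) B).comp (sndP B B)) (sndP (B × B) B)).comp T)).comp T

/-- `(a, b) ↦ b ⊗ a`. -/
def tensorSwap : (B × B) ⥤ᵖ B := (pairP (sndP B B) (fstP B B)).comp T

/-- `a ↦ e ⊗ a`. -/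
def tensorUnitLeft (e : B) : B ⥤ᵖ B := (pairP (constP B e) (Pseudofunctor.id B)).comp T

/-- `a ↦ a ⊗ e`. -/
def tensorUnitRight (e : B) : B ⥤ᵖ B := (pairP (Pseudofunctor.id B) (constP B e)).comp T

end TensorPseudofunctors

/-- The tensor product, unit, associator, unitors and braiding of a symmetric monoidal bicategory.
The four natural 2-transformations are adjoint equivalences in the bicategory of pseudofunctors,
strong transformations and modifications. -/
class TensorBicategory (B : Type u) [Bicategory.{w, v} B] where
  tensor : (B × B) ⥤ᵖ B
  unit : B
  associator : tensorLeft₃ tensor ≌ tensorRight₃ tensor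
  leftUnitor : tensorUnitLeft tensor unit ≌ Pseudofunctor.id B
  rightUnitor : Pseudofunctor.id B ≌ tensorUnitRight tensor unit
  braiding : tensor ≌ tensorSwap tensor

section Tensor

variable {B : Type u} [Bicategory.{w, v} B] [TensorBicategory B]

/-- Tensor product of objects. -/
def tObj (a b : B) : B := TensorBicategory.tensor.obj (a, b)

/-- The monoidal unit. -/
def tUnit (B : Type u) [Bicategory.{w, v} B] [TensorBicategory B] : B := TensorBicategory.unit

infixr:70 " ⊠ " => tObj

/-- Tensor product of 1-morphisms. -/
def tHom {a a' b b' : B} (f : a ⟶ a') (g : b ⟶ b') : a ⊠ b ⟶ a' ⊠ b' :=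
  TensorBicategory.tensor.map (X := (a, b)) (Y := (a', b')) (f, g)

infixr:82 " ⊠₁ " => tHom

/-- `f ⊗ b`. -/
abbrev tR {a a' : B} (f : a ⟶ a') (b : B) : a ⊠ b ⟶ a' ⊠ b := f ⊠₁ 𝟙 b

/-- `a ⊗ g`. -/
abbrev tL (a : B) {b b' : B} (g : b ⟶ b') : a ⊠ b ⟶ a ⊠ b' := 𝟙 a ⊠₁ g

infixl:84 " ▹ " => tR
infixr:84 " ◃ " => tL

/-- Tensor product of 2-morphisms. -/
def tHom₂ {a a' b b' : B} {f f' : a ⟶ a'} {g g' : b ⟶ b'} (η : f ⟶ f') (θ : g ⟶ g') :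
    f ⊠₁ g ⟶ f' ⊠₁ g' :=
  TensorBicategory.tensor.map₂ (a := (a, b)) (b := (a', b')) (f := (f, g)) (g := (f', g')) (η, θ)

/-- Tensor product of invertible 2-morphisms. -/
def tIso {a a' b b' : B} {f f' : a ⟶ a'} {g g' : b ⟶ b'} (η : f ≅ f') (θ : g ≅ g') :
    f ⊠₁ g ≅ f' ⊠₁ g' :=
  TensorBicategory.tensor.map₂Iso (a := (a, b)) (b := (a', b')) (f := (f, g)) (g := (f', g'))
    (Iso.prod η θ)

/-- Functoriality of the tensor product, for composites. -/
def tComp {a a' a'' b b' b'' : B} (f : a ⟶ a') (f' : a' ⟶ a'') (g : b ⟶ b') (g' : b' ⟶ b'') :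
    (f ≫ f') ⊠₁ (g ≫ g') ≅ f ⊠₁ g ≫ f' ⊠₁ g' :=
  TensorBicategory.tensor.mapComp (a := (a, b)) (b := (a', b')) (c := (a'', b'')) (f, g) (f', g')

/-- Functoriality of the tensor product, for identities. -/
def tId (a b : B) : 𝟙 a ⊠₁ 𝟙 b ≅ 𝟙 (a ⊠ b) :=
  TensorBicategory.tensor.mapId (a, b)

/-- The associator `(a ⊗ b) ⊗ c ⟶ a ⊗ (b ⊗ c)`. -/
def as (a b c : B) : (a ⊠ b) ⊠ c ⟶ a ⊠ (b ⊠ c) :=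
  TensorBicategory.associator.hom.app ((a, b), c)

/-- The chosen adjoint inverse `a ⊗ (b ⊗ c) ⟶ (a ⊗ b) ⊗ c` of the associator. -/
def as' (a b c : B) : a ⊠ (b ⊠ c) ⟶ (a ⊠ b) ⊠ c :=
  TensorBicategory.associator.inv.app ((a, b), c)

/-- The left unitor `1 ⊗ a ⟶ a`. -/
def lu (a : B) : tUnit B ⊠ a ⟶ a := TensorBicategory.leftUnitor.hom.app a

/-- The right unitor `a ⟶ a ⊗ 1`. -/
def ru (a : B) : a ⟶ a ⊠ tUnit B := TensorBicategory.rightUnitor.hom.app a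

/-- The braiding `a ⊗ b ⟶ b ⊗ a`. -/
def br (a b : B) : a ⊠ b ⟶ b ⊠ a := TensorBicategory.braiding.hom.app (a, b)

variable {a a' a'' b b' b'' c c' d e : B}

/-- Naturality of the associator. -/
def asNat (f : a ⟶ a') (g : b ⟶ b') (h : c ⟶ c') :
    (f ⊠₁ g) ⊠₁ h ≫ as a' b' c' ≅ as a b c ≫ f ⊠₁ (g ⊠₁ h) :=
  TensorBicategory.associator.hom.naturality (a := ((a, b), c)) (b := ((a', b'), c')) ((f, g), h)

/-- Naturality of the inverse associator. -/
def asNat' (f : a ⟶ a') (g : b ⟶ b') (h : c ⟶ c') :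
    f ⊠₁ (g ⊠₁ h) ≫ as' a' b' c' ≅ as' a b c ≫ (f ⊠₁ g) ⊠₁ h :=
  TensorBicategory.associator.inv.naturality (a := ((a, b), c)) (b := ((a', b'), c')) ((f, g), h)

/-- Naturality of the left unitor. -/
def luNat (f : a ⟶ a') : tUnit B ◃ f ≫ lu a' ≅ lu a ≫ f :=
  TensorBicategory.leftUnitor.hom.naturality f

/-- Naturality of the right unitor. -/
def ruNat (f : a ⟶ a') : f ≫ ru a' ≅ ru a ≫ f ▹ tUnit B :=
  TensorBicategory.rightUnitor.hom.naturality f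

/-- Naturality of the braiding. -/
def brNat (f : a ⟶ a') (g : b ⟶ b') : f ⊠₁ g ≫ br a' b' ≅ br a b ≫ g ⊠₁ f :=
  TensorBicategory.braiding.hom.naturality (a := (a, b)) (b := (a', b')) (f, g)

/-- The unit of the adjoint equivalence between the associator and its inverse. -/
def asUnit (a b c : B) : 𝟙 ((a ⊠ b) ⊠ c) ≅ as a b c ≫ as' a b c where
  hom := TensorBicategory.associator.unit.hom.as.app ((a, b), c)
  inv := TensorBicategory.associator.unit.inv.as.app ((a, b), c)
  hom_inv_id := congrArg (fun m => m.as.app ((a, b), c))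
    (TensorBicategory.associator (B := B)).unit.hom_inv_id
  inv_hom_id := congrArg (fun m => m.as.app ((a, b), c))
    (TensorBicategory.associator (B := B)).unit.inv_hom_id

/-- The counit of the adjoint equivalence between the associator and its inverse. -/
def asCounit (a b c : B) : as' a b c ≫ as a b c ≅ 𝟙 (a ⊠ (b ⊠ c)) where
  hom := TensorBicategory.associator.counit.hom.as.app ((a, b), c)
  inv := TensorBicategory.associator.counit.inv.as.app ((a, b), c)
  hom_inv_id := congrArg (fun m => m.as.app ((a, b), c))
    (TensorBicategory.associator (B := B)).counit.hom_inv_id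
  inv_hom_id := congrArg (fun m => m.as.app ((a, b), c))
    (TensorBicategory.associator (B := B)).counit.inv_hom_id

end Tensor

/-! ### Families of 1-cells with naturality 2-cells, and modifications between them -/

/-- The 1-cells and naturality 2-cells of a natural 2-transformation, without its axioms. This is
used to write down composites of natural 2-transformations when stating that a family of 2-morphisms
is a modification between such composites. -/
structure Cells {X : Type u₂} [Quiver.{v₂} X] {B : Type u} [Bicategory.{w, v} B] (F G : X ⥤q B) where
  app (x : X) : F.obj x ⟶ G.obj x
  cell {x y : X} (f : x ⟶ y) : app x ≫ G.map f ⟶ F.map f ≫ app y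

/-- The family `m` is a modification from `σ` to `τ`. -/
def IsModification {X : Type u₂} [Quiver.{v₂} X] {B : Type u} [Bicategory.{w, v} B] {F G : X ⥤q B}
    (σ τ : Cells F G) (m : ∀ x, σ.app x ⟶ τ.app x) : Prop :=
  ∀ ⦃x y : X⦄ (f : x ⟶ y), m x ▷ G.map f ≫ τ.cell f = σ.cell f ≫ F.map f ◁ m y

namespace Cells

variable {X : Type u₂} [Quiver.{v₂} X] {B : Type u} [Bicategory.{w, v} B]

/-- Identity. -/
def id (F : X ⥤q B) : Cells F F where
  app x := 𝟙 (F.obj x)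
  cell f := (λ_ (F.map f)).hom ≫ (ρ_ (F.map f)).inv

/-- Composition of natural 2-transformations. -/
def comp {F G H : X ⥤q B} (σ : Cells F G) (τ : Cells G H) : Cells F H where
  app x := σ.app x ≫ τ.app x
  cell {x y} f := (α_ _ _ _).hom ≫ σ.app x ◁ τ.cell f ≫ (α_ _ _ _).inv ≫
    σ.cell f ▷ τ.app y ≫ (α_ _ _ _).hom

infixr:60 " ⋙c " => comp

end Cells

section TensorCells

variable {X : Type u₂} [Quiver.{v₂} X] {B : Type u} [Bicategory.{w, v} B] [TensorBicategory B]

/-- Pointwise tensor product. -/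
def tPre (F G : X ⥤q B) : X ⥤q B where
  obj x := F.obj x ⊠ G.obj x
  map f := F.map f ⊠₁ G.map f

infixr:70 " ⊠q " => tPre

/-- The constant diagram at the monoidal unit. -/
def unitPre (X : Type u₂) [Quiver.{v₂} X] (B : Type u) [Bicategory.{w, v} B]
    [TensorBicategory B] : X ⥤q B where
  obj _ := tUnit B
  map _ := 𝟙 (tUnit B)

namespace Cells

/-- Tensor product of natural 2-transformations. -/
def tens {F G F' G' : X ⥤q B} (σ : Cells F G) (τ : Cells F' G') : Cells (F ⊠q F') (G ⊠q G') where
  app x := σ.app x ⊠₁ τ.app x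
  cell {x y} f := (tComp (σ.app x) (G.map f) (τ.app x) (G'.map f)).inv ≫
    tHom₂ (σ.cell f) (τ.cell f) ≫ (tComp (F.map f) (σ.app y) (F'.map f) (τ.app y)).hom

infixr:70 " ⊠c " => tens

/-- The associator, as a natural 2-transformation in three variables. -/
def asC (P Q R : X ⥤q B) : Cells ((P ⊠q Q) ⊠q R) (P ⊠q (Q ⊠q R)) where
  app x := as (P.obj x) (Q.obj x) (R.obj x)
  cell f := (asNat (P.map f) (Q.map f) (R.map f)).inv

/-- The inverse associator. -/
def asC' (P Q R : X ⥤q B) : Cells (P ⊠q (Q ⊠q R)) ((P ⊠q Q) ⊠q R) where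
  app x := as' (P.obj x) (Q.obj x) (R.obj x)
  cell f := (asNat' (P.map f) (Q.map f) (R.map f)).inv

/-- The left unitor. -/
def luC (P : X ⥤q B) : Cells (unitPre X B ⊠q P) P where
  app x := lu (P.obj x)
  cell f := (luNat (P.map f)).inv

/-- The right unitor. -/
def ruC (P : X ⥤q B) : Cells P (P ⊠q unitPre X B) where
  app x := ru (P.obj x)
  cell f := (ruNat (P.map f)).inv

/-- The braiding. -/
def brC (P Q : X ⥤q B) : Cells (P ⊠q Q) (Q ⊠q P) where
  app x := br (P.obj x) (Q.obj x)
  cell f := (brNat (P.map f) (Q.map f)).inv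

end Cells

end TensorCells

section Projections

variable (B : Type u) [Bicategory.{w, v} B]

/-- First of two variables. -/
def p₁ : (B × B) ⥤q B where
  obj x := x.1
  map f := f.1

/-- Second of two variables. -/
def p₂ : (B × B) ⥤q B where
  obj x := x.2
  map f := f.2

/-- First of three variables. -/
def q₁ : (B × B × B) ⥤q B where
  obj x := x.1
  map f := f.1

/-- Second of three variables. -/
def q₂ : (B × B × B) ⥤q B where
  obj x := x.2.1
  map f := f.2.1

/-- Third of three variables. -/
def q₃ : (B × B × B) ⥤q B where
  obj x := x.2.2
  map f := f.2.2

/-- First of four variables. -/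
def r₁ : (B × B × B × B) ⥤q B where
  obj x := x.1
  map f := f.1

/-- Second of four variables. -/
def r₂ : (B × B × B × B) ⥤q B where
  obj x := x.2.1
  map f := f.2.1

/-- Third of four variables. -/
def r₃ : (B × B × B × B) ⥤q B where
  obj x := x.2.2.1
  map f := f.2.2.1

/-- Fourth of four variables. -/
def r₄ : (B × B × B × B) ⥤q B where
  obj x := x.2.2.2
  map f := f.2.2.2

end Projections

/-- The data of a symmetric monoidal bicategory: the tensor product, unit, associator, unitors and
braiding, together with the invertible modifications of a symmetric monoidal bicategory. -/
class SymMonData (B : Type u) [Bicategory.{w, v} B] extends TensorBicategory B where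
  pent (a b c d : B) :
    as a b c ▹ d ≫ as a (b ⊠ c) d ≫ a ◃ as b c d ≅ as (a ⊠ b) c d ≫ as a b (c ⊠ d)
  pent_mod : IsModification
    (((Cells.asC (r₁ B) (r₂ B) (r₃ B)) ⊠c Cells.id (r₄ B)) ⋙c
      Cells.asC (r₁ B) (r₂ B ⊠q r₃ B) (r₄ B) ⋙c
        (Cells.id (r₁ B) ⊠c Cells.asC (r₂ B) (r₃ B) (r₄ B)))
    (Cells.asC (r₁ B ⊠q r₂ B) (r₃ B) (r₄ B) ⋙c Cells.asC (r₁ B) (r₂ B) (r₃ B ⊠q r₄ B))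
    (fun x => (pent x.1 x.2.1 x.2.2.1 x.2.2.2).hom)
  midUnit (a b : B) : ru a ▹ b ≫ as a (tUnit B) b ≫ a ◃ lu b ≅ 𝟙 (a ⊠ b)
  midUnit_mod : IsModification
    ((Cells.ruC (p₁ B) ⊠c Cells.id (p₂ B)) ⋙c Cells.asC (p₁ B) (unitPre (B × B) B) (p₂ B) ⋙c
      (Cells.id (p₁ B) ⊠c Cells.luC (p₂ B)))
    (Cells.id (p₁ B ⊠q p₂ B))
    (fun x => (midUnit x.1 x.2).hom)
  leftUnit (a b : B) : lu a ▹ b ≅ as (tUnit B) a b ≫ lu (a ⊠ b)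
  leftUnit_mod : IsModification
    (Cells.luC (p₁ B) ⊠c Cells.id (p₂ B))
    (Cells.asC (unitPre (B × B) B) (p₁ B) (p₂ B) ⋙c Cells.luC (p₁ B ⊠q p₂ B))
    (fun x => (leftUnit x.1 x.2).hom)
  rightUnit (a b : B) : a ◃ ru b ≅ ru (a ⊠ b) ≫ as a b (tUnit B)
  rightUnit_mod : IsModification
    (Cells.id (p₁ B) ⊠c Cells.ruC (p₂ B))
    (Cells.ruC (p₁ B ⊠q p₂ B) ⋙c Cells.asC (p₁ B) (p₂ B) (unitPre (B × B) B))
    (fun x => (rightUnit x.1 x.2).hom)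
  hexR (a b c : B) :
    as a b c ≫ br a (b ⊠ c) ≫ as b c a ≅ br a b ▹ c ≫ as b a c ≫ b ◃ br a c
  hexR_mod : IsModification
    (Cells.asC (q₁ B) (q₂ B) (q₃ B) ⋙c Cells.brC (q₁ B) (q₂ B ⊠q q₃ B) ⋙c
      Cells.asC (q₂ B) (q₃ B) (q₁ B))
    ((Cells.brC (q₁ B) (q₂ B) ⊠c Cells.id (q₃ B)) ⋙c Cells.asC (q₂ B) (q₁ B) (q₃ B) ⋙c
      (Cells.id (q₂ B) ⊠c Cells.brC (q₁ B) (q₃ B)))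
    (fun x => (hexR x.1 x.2.1 x.2.2).hom)
  hexS (a b c : B) :
    as' a b c ≫ br (a ⊠ b) c ≫ as' c a b ≅ a ◃ br b c ≫ as' a c b ≫ br a c ▹ b
  hexS_mod : IsModification
    (Cells.asC' (q₁ B) (q₂ B) (q₃ B) ⋙c Cells.brC (q₁ B ⊠q q₂ B) (q₃ B) ⋙c
      Cells.asC' (q₃ B) (q₁ B) (q₂ B))
    ((Cells.id (q₁ B) ⊠c Cells.brC (q₂ B) (q₃ B)) ⋙c Cells.asC' (q₁ B) (q₃ B) (q₂ B) ⋙c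
      (Cells.brC (q₁ B) (q₃ B) ⊠c Cells.id (q₂ B)))
    (fun x => (hexS x.1 x.2.1 x.2.2).hom)
  syll (a b : B) : 𝟙 (a ⊠ b) ≅ br a b ≫ br b a
  syll_mod : IsModification
    (Cells.id (p₁ B ⊠q p₂ B))
    (Cells.brC (p₁ B) (p₂ B) ⋙c Cells.brC (p₂ B) (p₁ B))
    (fun x => (syll x.1 x.2).hom)

/-! ### Auxiliary invertible 2-morphisms -/

section Auxiliary

variable {B : Type u} [Bicategory.{w, v} B] [TensorBicategory B]

/-- `η ⊗ c`. -/
abbrev isoR {a a' : B} {f f' : a ⟶ a'} (η : f ≅ f') (c : B) : f ▹ c ≅ f' ▹ c :=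
  tIso η (Iso.refl _)

/-- `a ⊗ η`. -/
abbrev isoL (a : B) {b b' : B} {g g' : b ⟶ b'} (η : g ≅ g') : a ◃ g ≅ a ◃ g' :=
  tIso (Iso.refl _) η

variable {a a' a₁ a₂ a₃ a₄ a₅ b b' c c' : B}

/-- `(f₁ ≫ f₂) ⊗ c ≅ (f₁ ⊗ c) ≫ (f₂ ⊗ c)`. -/
def wr2 (f₁ : a ⟶ a₁) (f₂ : a₁ ⟶ a₂) (c : B) : (f₁ ≫ f₂) ▹ c ≅ f₁ ▹ c ≫ f₂ ▹ c :=
  tIso (Iso.refl _) (λ_ (𝟙 c)).symm ≪≫ tComp f₁ f₂ (𝟙 c) (𝟙 c)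

/-- `c ⊗ (f₁ ≫ f₂) ≅ (c ⊗ f₁) ≫ (c ⊗ f₂)`. -/
def wl2 (c : B) (f₁ : a ⟶ a₁) (f₂ : a₁ ⟶ a₂) : c ◃ (f₁ ≫ f₂) ≅ c ◃ f₁ ≫ c ◃ f₂ :=
  tIso (λ_ (𝟙 c)).symm (Iso.refl _) ≪≫ tComp (𝟙 c) (𝟙 c) f₁ f₂

/-- `(f₁ ≫ f₂ ≫ f₃) ⊗ c ≅ (f₁ ⊗ c) ≫ (f₂ ⊗ c) ≫ (f₃ ⊗ c)`. -/
def wr3 (f₁ : a ⟶ a₁) (f₂ : a₁ ⟶ a₂) (f₃ : a₂ ⟶ a₃) (c : B) :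
    (f₁ ≫ f₂ ≫ f₃) ▹ c ≅ f₁ ▹ c ≫ f₂ ▹ c ≫ f₃ ▹ c :=
  wr2 f₁ (f₂ ≫ f₃) c ≪≫ (f₁ ▹ c) ◁ᵢ wr2 f₂ f₃ c

/-- `c ⊗ (f₁ ≫ f₂ ≫ f₃) ≅ (c ⊗ f₁) ≫ (c ⊗ f₂) ≫ (c ⊗ f₃)`. -/
def wl3 (c : B) (f₁ : a ⟶ a₁) (f₂ : a₁ ⟶ a₂) (f₃ : a₂ ⟶ a₃) :
    c ◃ (f₁ ≫ f₂ ≫ f₃) ≅ c ◃ f₁ ≫ c ◃ f₂ ≫ c ◃ f₃ :=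
  wl2 c f₁ (f₂ ≫ f₃) ≪≫ (c ◃ f₁) ◁ᵢ wl2 c f₂ f₃

/-- The analogous isomorphism for five factors. -/
def wr5 (f₁ : a ⟶ a₁) (f₂ : a₁ ⟶ a₂) (f₃ : a₂ ⟶ a₃) (f₄ : a₃ ⟶ a₄) (f₅ : a₄ ⟶ a₅) (c : B) :
    (f₁ ≫ f₂ ≫ f₃ ≫ f₄ ≫ f₅) ▹ c ≅ f₁ ▹ c ≫ f₂ ▹ c ≫ f₃ ▹ c ≫ f₄ ▹ c ≫ f₅ ▹ c :=
  wr3 f₁ f₂ (f₃ ≫ f₄ ≫ f₅) c ≪≫ (f₁ ▹ c) ◁ᵢ (f₂ ▹ c) ◁ᵢ wr3 f₃ f₄ f₅ c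

/-- The analogous isomorphism for five factors. -/
def wl5 (c : B) (f₁ : a ⟶ a₁) (f₂ : a₁ ⟶ a₂) (f₃ : a₂ ⟶ a₃) (f₄ : a₃ ⟶ a₄) (f₅ : a₄ ⟶ a₅) :
    c ◃ (f₁ ≫ f₂ ≫ f₃ ≫ f₄ ≫ f₅) ≅ c ◃ f₁ ≫ c ◃ f₂ ≫ c ◃ f₃ ≫ c ◃ f₄ ≫ c ◃ f₅ :=
  wl3 c f₁ f₂ (f₃ ≫ f₄ ≫ f₅) ≪≫ (c ◃ f₁) ◁ᵢ (c ◃ f₂) ◁ᵢ wl3 c f₃ f₄ f₅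

/-- `f ⊠₁ g ≅ (f ⊗ b) ≫ (a' ⊗ g)`. -/
def splitRL (f : a ⟶ a') (g : b ⟶ b') : f ⊠₁ g ≅ f ▹ b ≫ a' ◃ g :=
  tIso (ρ_ f).symm (λ_ g).symm ≪≫ tComp f (𝟙 a') (𝟙 b) g

/-- `f ⊠₁ g ≅ (a ⊗ g) ≫ (f ⊗ b')`. -/
def splitLR (f : a ⟶ a') (g : b ⟶ b') : f ⊠₁ g ≅ a ◃ g ≫ f ▹ b' :=
  tIso (λ_ f).symm (ρ_ g).symm ≪≫ tComp (𝟙 a) f g (𝟙 b')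

/-- The interchange isomorphism. -/
def inter (f : a ⟶ a') (g : b ⟶ b') : f ▹ b ≫ a' ◃ g ≅ a ◃ g ≫ f ▹ b' :=
  (splitRL f g).symm ≪≫ splitLR f g

/-- Naturality of the associator in the first variable. -/
def asN₁ (f : a ⟶ a') (b c : B) : (f ▹ b) ▹ c ≫ as a' b c ≅ as a b c ≫ f ▹ (b ⊠ c) :=
  asNat f (𝟙 b) (𝟙 c) ≪≫ as a b c ◁ᵢ tIso (Iso.refl f) (tId b c)

/-- Naturality of the associator in the second variable. -/
def asN₂ (a : B) (g : b ⟶ b') (c : B) : (a ◃ g) ▹ c ≫ as a b' c ≅ as a b c ≫ a ◃ (g ▹ c) :=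
  asNat (𝟙 a) g (𝟙 c)

/-- Naturality of the associator in the third variable. -/
def asN₃ (a b : B) (h : c ⟶ c') : (a ⊠ b) ◃ h ≫ as a b c' ≅ as a b c ≫ a ◃ (b ◃ h) :=
  tIso (tId a b).symm (Iso.refl h) ▷ᵢ as a b c' ≪≫ asNat (𝟙 a) (𝟙 b) h

/-- Naturality of the inverse associator in the first variable. -/
def asN₁' (f : a ⟶ a') (b c : B) : f ▹ (b ⊠ c) ≫ as' a' b c ≅ as' a b c ≫ (f ▹ b) ▹ c :=
  tIso (Iso.refl f) (tId b c).symm ▷ᵢ as' a' b c ≪≫ asNat' f (𝟙 b) (𝟙 c)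

/-- Naturality of the inverse associator in the second variable. -/
def asN₂' (a : B) (g : b ⟶ b') (c : B) : a ◃ (g ▹ c) ≫ as' a b' c ≅ as' a b c ≫ (a ◃ g) ▹ c :=
  asNat' (𝟙 a) g (𝟙 c)

/-- Naturality of the inverse associator in the third variable. -/
def asN₃' (a b : B) (h : c ⟶ c') : a ◃ (b ◃ h) ≫ as' a b c' ≅ as' a b c ≫ (a ⊠ b) ◃ h :=
  asNat' (𝟙 a) (𝟙 b) h ≪≫ as' a b c ◁ᵢ tIso (tId a b) (Iso.refl h)

/-- Naturality of the braiding in the first variable. -/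
def brN₁ (f : a ⟶ a') (b : B) : f ▹ b ≫ br a' b ≅ br a b ≫ b ◃ f := brNat f (𝟙 b)

/-- Naturality of the braiding in the second variable. -/
def brN₂ (a : B) (g : b ⟶ b') : a ◃ g ≫ br a b' ≅ br a b ≫ g ▹ a := brNat (𝟙 a) g

/-- Tensor an isomorphism `𝟙 ≅ f ≫ g` with an object on the right. -/
def tr02 {f : a ⟶ a'} {g : a' ⟶ a} (η : 𝟙 a ≅ f ≫ g) (c : B) : 𝟙 (a ⊠ c) ≅ f ▹ c ≫ g ▹ c :=
  (tId a c).symm ≪≫ isoR η c ≪≫ wr2 f g c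

/-- Tensor an isomorphism `𝟙 ≅ f ≫ g` with an object on the left. -/
def tl02 (c : B) {f : a ⟶ a'} {g : a' ⟶ a} (η : 𝟙 a ≅ f ≫ g) : 𝟙 (c ⊠ a) ≅ c ◃ f ≫ c ◃ g :=
  (tId c a).symm ≪≫ isoL c η ≪≫ wl2 c f g

/-- Tensor an isomorphism `f ≅ g₁ ≫ g₂` with an object on the right. -/
def tr12 {f : a ⟶ a'} {g₁ : a ⟶ a₁} {g₂ : a₁ ⟶ a'} (η : f ≅ g₁ ≫ g₂) (c : B) :
    f ▹ c ≅ g₁ ▹ c ≫ g₂ ▹ c :=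
  isoR η c ≪≫ wr2 g₁ g₂ c

/-- Tensor an isomorphism `f ≅ g₁ ≫ g₂` with an object on the left. -/
def tl12 (c : B) {f : a ⟶ a'} {g₁ : a ⟶ a₁} {g₂ : a₁ ⟶ a'} (η : f ≅ g₁ ≫ g₂) :
    c ◃ f ≅ c ◃ g₁ ≫ c ◃ g₂ :=
  isoL c η ≪≫ wl2 c g₁ g₂

/-- Tensor an isomorphism `f ≅ g₁ ≫ g₂ ≫ g₃ ≫ g₄ ≫ g₅` with an object on the right. -/
def tr15 {f : a ⟶ a'} {g₁ : a ⟶ a₁} {g₂ : a₁ ⟶ a₂} {g₃ : a₂ ⟶ a₃} {g₄ : a₃ ⟶ a₄} {g₅ : a₄ ⟶ a'}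
    (η : f ≅ g₁ ≫ g₂ ≫ g₃ ≫ g₄ ≫ g₅) (c : B) :
    f ▹ c ≅ g₁ ▹ c ≫ g₂ ▹ c ≫ g₃ ▹ c ≫ g₄ ▹ c ≫ g₅ ▹ c :=
  isoR η c ≪≫ wr5 g₁ g₂ g₃ g₄ g₅ c

/-- Tensor an isomorphism `f ≅ g₁ ≫ g₂ ≫ g₃ ≫ g₄ ≫ g₅` with an object on the left. -/
def tl15 (c : B) {f : a ⟶ a'} {g₁ : a ⟶ a₁} {g₂ : a₁ ⟶ a₂} {g₃ : a₂ ⟶ a₃} {g₄ : a₃ ⟶ a₄}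
    {g₅ : a₄ ⟶ a'} (η : f ≅ g₁ ≫ g₂ ≫ g₃ ≫ g₄ ≫ g₅) :
    c ◃ f ≅ c ◃ g₁ ≫ c ◃ g₂ ≫ c ◃ g₃ ≫ c ◃ g₄ ≫ c ◃ g₅ :=
  isoL c η ≪≫ wl5 c g₁ g₂ g₃ g₄ g₅

/-- Tensor an isomorphism `f₁ ≫ f₂ ≅ g₁ ≫ g₂` with an object on the right. -/
def tr22 {f₁ : a ⟶ a₁} {f₂ : a₁ ⟶ a'} {g₁ : a ⟶ a₃} {g₂ : a₃ ⟶ a'} (η : f₁ ≫ f₂ ≅ g₁ ≫ g₂) (c : B) :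
    f₁ ▹ c ≫ f₂ ▹ c ≅ g₁ ▹ c ≫ g₂ ▹ c :=
  (wr2 f₁ f₂ c).symm ≪≫ isoR η c ≪≫ wr2 g₁ g₂ c

/-- Tensor an isomorphism `f₁ ≫ f₂ ≅ g₁ ≫ g₂` with an object on the left. -/
def tl22 (c : B) {f₁ : a ⟶ a₁} {f₂ : a₁ ⟶ a'} {g₁ : a ⟶ a₃} {g₂ : a₃ ⟶ a'} (η : f₁ ≫ f₂ ≅ g₁ ≫ g₂) :
    c ◃ f₁ ≫ c ◃ f₂ ≅ c ◃ g₁ ≫ c ◃ g₂ :=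
  (wl2 c f₁ f₂).symm ≪≫ isoL c η ≪≫ wl2 c g₁ g₂

section

variable {f₁ : a ⟶ a₁} {f₂ : a₁ ⟶ a₂} {f₃ : a₂ ⟶ a'}

/-- Tensor an isomorphism `f₁ ≫ f₂ ≫ f₃ ≅ g₁ ≫ g₂` with an object on the right. -/
def tr32 {g₁ : a ⟶ a₃} {g₂ : a₃ ⟶ a'} (η : f₁ ≫ f₂ ≫ f₃ ≅ g₁ ≫ g₂) (c : B) :
    f₁ ▹ c ≫ f₂ ▹ c ≫ f₃ ▹ c ≅ g₁ ▹ c ≫ g₂ ▹ c :=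
  (wr3 f₁ f₂ f₃ c).symm ≪≫ isoR η c ≪≫ wr2 g₁ g₂ c

/-- Tensor an isomorphism `f₁ ≫ f₂ ≫ f₃ ≅ g₁ ≫ g₂` with an object on the left. -/
def tl32 (c : B) {g₁ : a ⟶ a₃} {g₂ : a₃ ⟶ a'} (η : f₁ ≫ f₂ ≫ f₃ ≅ g₁ ≫ g₂) :
    c ◃ f₁ ≫ c ◃ f₂ ≫ c ◃ f₃ ≅ c ◃ g₁ ≫ c ◃ g₂ :=
  (wl3 c f₁ f₂ f₃).symm ≪≫ isoL c η ≪≫ wl2 c g₁ g₂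

/-- Tensor an isomorphism `f₁ ≫ f₂ ≫ f₃ ≅ g₁ ≫ g₂ ≫ g₃` with an object on the right. -/
def tr33 {g₁ : a ⟶ a₃} {g₂ : a₃ ⟶ a₄} {g₃ : a₄ ⟶ a'} (η : f₁ ≫ f₂ ≫ f₃ ≅ g₁ ≫ g₂ ≫ g₃) (c : B) :
    f₁ ▹ c ≫ f₂ ▹ c ≫ f₃ ▹ c ≅ g₁ ▹ c ≫ g₂ ▹ c ≫ g₃ ▹ c :=
  (wr3 f₁ f₂ f₃ c).symm ≪≫ isoR η c ≪≫ wr3 g₁ g₂ g₃ c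

/-- Tensor an isomorphism `f₁ ≫ f₂ ≫ f₃ ≅ g₁ ≫ g₂ ≫ g₃` with an object on the left. -/
def tl33 (c : B) {g₁ : a ⟶ a₃} {g₂ : a₃ ⟶ a₄} {g₃ : a₄ ⟶ a'} (η : f₁ ≫ f₂ ≫ f₃ ≅ g₁ ≫ g₂ ≫ g₃) :
    c ◃ f₁ ≫ c ◃ f₂ ≫ c ◃ f₃ ≅ c ◃ g₁ ≫ c ◃ g₂ ≫ c ◃ g₃ :=
  (wl3 c f₁ f₂ f₃).symm ≪≫ isoL c η ≪≫ wl3 c g₁ g₂ g₃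

end

section

variable {f₁ : a ⟶ a₁} {f₂ : a₁ ⟶ a₂} {f₃ : a₂ ⟶ a}

/-- Tensor an isomorphism `f₁ ≫ f₂ ≫ f₃ ≅ 𝟙` with an object on the right. -/
def tr30 (η : f₁ ≫ f₂ ≫ f₃ ≅ 𝟙 a) (c : B) : f₁ ▹ c ≫ f₂ ▹ c ≫ f₃ ▹ c ≅ 𝟙 (a ⊠ c) :=
  (wr3 f₁ f₂ f₃ c).symm ≪≫ isoR η c ≪≫ tId a c

/-- Tensor an isomorphism `f₁ ≫ f₂ ≫ f₃ ≅ 𝟙` with an object on the left. -/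
def tl30 (c : B) (η : f₁ ≫ f₂ ≫ f₃ ≅ 𝟙 a) : c ◃ f₁ ≫ c ◃ f₂ ≫ c ◃ f₃ ≅ 𝟙 (c ⊠ a) :=
  (wl3 c f₁ f₂ f₃).symm ≪≫ isoL c η ≪≫ tId c a

end

end Auxiliary

section Mates

variable {B : Type u} [Bicategory.{w, v} B] [SymMonData B]

open SymMonData

/-- The pentagon modification for the inverse associators. -/
def pent' (a b c d : B) :
    a ◃ as' b c d ≫ as' a (b ⊠ c) d ≫ as' a b c ▹ d ≅ as' a b (c ⊠ d) ≫ as' (a ⊠ b) c d :=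
  Iso.refl _ ≪⊗≫ (a ◃ as' b c d ≫ as' a (b ⊠ c) d ≫ as' a b c ▹ d) ◁ᵢ asUnit (a ⊠ b) c d
  ≪⊗≫ (a ◃ as' b c d ≫ as' a (b ⊠ c) d ≫ as' a b c ▹ d ≫ as (a ⊠ b) c d) ◁ᵢ
    asUnit a b (c ⊠ d) ▷ᵢ as' (a ⊠ b) c d
  ≪⊗≫ (a ◃ as' b c d ≫ as' a (b ⊠ c) d ≫ as' a b c ▹ d) ◁ᵢ (pent a b c d).symm ▷ᵢ
    (as' a b (c ⊠ d) ≫ as' (a ⊠ b) c d)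
  ≪⊗≫ (a ◃ as' b c d ≫ as' a (b ⊠ c) d) ◁ᵢ (tr02 (asCounit a b c).symm d).symm ▷ᵢ
    (as a (b ⊠ c) d ≫ a ◃ as b c d ≫ as' a b (c ⊠ d) ≫ as' (a ⊠ b) c d)
  ≪⊗≫ a ◃ as' b c d ◁ᵢ asCounit a (b ⊠ c) d ▷ᵢ
    (a ◃ as b c d ≫ as' a b (c ⊠ d) ≫ as' (a ⊠ b) c d)
  ≪⊗≫ (tl02 a (asCounit b c d).symm).symm ▷ᵢ (as' a b (c ⊠ d) ≫ as' (a ⊠ b) c d)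
  ≪⊗≫ Iso.refl _

/-- A mate of the pentagon modification. -/
def pentA (a b c d : B) :
    as' (a ⊠ b) c d ≫ as a b c ▹ d ≫ as a (b ⊠ c) d ≅ as a b (c ⊠ d) ≫ a ◃ as' b c d :=
  Iso.refl _ ≪⊗≫ (as' (a ⊠ b) c d ≫ as a b c ▹ d ≫ as a (b ⊠ c) d) ◁ᵢ tl02 a (asUnit b c d)
  ≪⊗≫ as' (a ⊠ b) c d ◁ᵢ pent a b c d ▷ᵢ a ◃ as' b c d
  ≪⊗≫ asCounit (a ⊠ b) c d ▷ᵢ (as a b (c ⊠ d) ≫ a ◃ as' b c d)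
  ≪⊗≫ Iso.refl _

/-- A mate of the pentagon modification. -/
def pentB (a b c d : B) :
    as' a (b ⊠ c) d ≫ as' a b c ▹ d ≫ as (a ⊠ b) c d ≅ a ◃ as b c d ≫ as' a b (c ⊠ d) :=
  Iso.refl _ ≪⊗≫ (as' a (b ⊠ c) d ≫ as' a b c ▹ d ≫ as (a ⊠ b) c d) ◁ᵢ asUnit a b (c ⊠ d)
  ≪⊗≫ (as' a (b ⊠ c) d ≫ as' a b c ▹ d) ◁ᵢ (pent a b c d).symm ▷ᵢ as' a b (c ⊠ d)
  ≪⊗≫ as' a (b ⊠ c) d ◁ᵢ (tr02 (asCounit a b c).symm d).symm ▷ᵢ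
    (as a (b ⊠ c) d ≫ a ◃ as b c d ≫ as' a b (c ⊠ d))
  ≪⊗≫ asCounit a (b ⊠ c) d ▷ᵢ (a ◃ as b c d ≫ as' a b (c ⊠ d))
  ≪⊗≫ Iso.refl _

/-- A mate of the pentagon modification. -/
def pentC (a b c d : B) :
    as a (b ⊠ c) d ≫ a ◃ as b c d ≫ as' a b (c ⊠ d) ≅ as' a b c ▹ d ≫ as (a ⊠ b) c d :=
  Iso.refl _ ≪⊗≫ tr02 (asCounit a b c).symm d ▷ᵢ (as a (b ⊠ c) d ≫ a ◃ as b c d ≫ as' a b (c ⊠ d))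
  ≪⊗≫ as' a b c ▹ d ◁ᵢ pent a b c d ▷ᵢ as' a b (c ⊠ d)
  ≪⊗≫ (as' a b c ▹ d ≫ as (a ⊠ b) c d) ◁ᵢ (asUnit a b (c ⊠ d)).symm
  ≪⊗≫ Iso.refl _

/-- The first hexagon modification, solved for the braiding with a tensor product. -/
def hexR' (a b c : B) :
    br a (b ⊠ c) ≅ as' a b c ≫ br a b ▹ c ≫ as b a c ≫ b ◃ br a c ≫ as' b c a :=
  Iso.refl _ ≪⊗≫ (asCounit a b c).symm ▷ᵢ br a (b ⊠ c)
  ≪⊗≫ (as' a b c ≫ as a b c ≫ br a (b ⊠ c)) ◁ᵢ asUnit b c a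
  ≪⊗≫ as' a b c ◁ᵢ hexR a b c ▷ᵢ as' b c a
  ≪⊗≫ Iso.refl _

/-- The second hexagon modification, solved for the braiding with a tensor product. -/
def hexS' (a b c : B) :
    br (a ⊠ b) c ≅ as a b c ≫ a ◃ br b c ≫ as' a c b ≫ br a c ▹ b ≫ as c a b :=
  Iso.refl _ ≪⊗≫ asUnit a b c ▷ᵢ br (a ⊠ b) c
  ≪⊗≫ (as a b c ≫ as' a b c ≫ br (a ⊠ b) c) ◁ᵢ (asCounit c a b).symm
  ≪⊗≫ as a b c ◁ᵢ hexS a b c ▷ᵢ as c a b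
  ≪⊗≫ Iso.refl _

end Mates

open SymMonData in
/-- Symmetric monoidal bicategories. Each law states that two composites of the structure
2-morphisms (up to the coherence isomorphisms of the bicategory) agree. -/
class SymMonBicategory (B : Type u) [Bicategory.{w, v} B] extends SymMonData B where
  /-- The associahedron: two ways of applying the pentagon modification to five objects. -/
  assoc_assoc (a b c d e : B) :
    Iso.refl ((as a b c ▹ d) ▹ e ≫ as a (b ⊠ c) d ▹ e ≫ (a ◃ as b c d) ▹ e ≫
        as a (b ⊠ c ⊠ d) e ≫ a ◃ as b (c ⊠ d) e ≫ a ◃ (b ◃ as c d e))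
      ≪⊗≫ tr32 (pent a b c d) e ▷ᵢ
        (as a (b ⊠ c ⊠ d) e ≫ a ◃ as b (c ⊠ d) e ≫ a ◃ (b ◃ as c d e))
      ≪⊗≫ as (a ⊠ b) c d ▹ e ◁ᵢ pent a b (c ⊠ d) e ▷ᵢ a ◃ (b ◃ as c d e)
      ≪⊗≫ (as (a ⊠ b) c d ▹ e ≫ as (a ⊠ b) (c ⊠ d) e) ◁ᵢ (asN₃ a b (as c d e)).symm
      ≪⊗≫ pent (a ⊠ b) c d e ▷ᵢ as a b (c ⊠ d ⊠ e)
      ≪⊗≫ Iso.refl (as ((a ⊠ b) ⊠ c) d e ≫ as (a ⊠ b) c (d ⊠ e) ≫ as a b (c ⊠ d ⊠ e))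
    = Iso.refl ((as a b c ▹ d) ▹ e ≫ as a (b ⊠ c) d ▹ e ≫ (a ◃ as b c d) ▹ e ≫
        as a (b ⊠ c ⊠ d) e ≫ a ◃ as b (c ⊠ d) e ≫ a ◃ (b ◃ as c d e))
      ≪⊗≫ ((as a b c ▹ d) ▹ e ≫ as a (b ⊠ c) d ▹ e) ◁ᵢ asN₂ a (as b c d) e ▷ᵢ
        (a ◃ as b (c ⊠ d) e ≫ a ◃ (b ◃ as c d e))
      ≪⊗≫ ((as a b c ▹ d) ▹ e ≫ as a (b ⊠ c) d ▹ e ≫ as a ((b ⊠ c) ⊠ d) e) ◁ᵢ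
        tl32 a (pent b c d e)
      ≪⊗≫ (as a b c ▹ d) ▹ e ◁ᵢ pent a (b ⊠ c) d e ▷ᵢ a ◃ as b c (d ⊠ e)
      ≪⊗≫ asN₁ (as a b c) d e ▷ᵢ (as a (b ⊠ c) (d ⊠ e) ≫ a ◃ as b c (d ⊠ e))
      ≪⊗≫ as ((a ⊠ b) ⊠ c) d e ◁ᵢ pent a b c (d ⊠ e)
      ≪⊗≫ Iso.refl (as ((a ⊠ b) ⊠ c) d e ≫ as (a ⊠ b) c (d ⊠ e) ≫ as a b (c ⊠ d ⊠ e))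
  /-- Unit coherence, with the unit in the second place. -/
  assoc_leftUnit (a b c : B) :
    Iso.refl ((ru a ▹ b) ▹ c ≫ as a (tUnit B) b ▹ c ≫ (a ◃ lu b) ▹ c ≫ as a b c)
      ≪⊗≫ tr30 (midUnit a b) c ▷ᵢ as a b c
      ≪⊗≫ Iso.refl (as a b c)
    = Iso.refl ((ru a ▹ b) ▹ c ≫ as a (tUnit B) b ▹ c ≫ (a ◃ lu b) ▹ c ≫ as a b c)
      ≪⊗≫ ((ru a ▹ b) ▹ c ≫ as a (tUnit B) b ▹ c) ◁ᵢ asN₂ a (lu b) c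
      ≪⊗≫ ((ru a ▹ b) ▹ c ≫ as a (tUnit B) b ▹ c ≫ as a (tUnit B ⊠ b) c) ◁ᵢ
        tl12 a (leftUnit b c)
      ≪⊗≫ (ru a ▹ b) ▹ c ◁ᵢ pent a (tUnit B) b c ▷ᵢ a ◃ lu (b ⊠ c)
      ≪⊗≫ asN₁ (ru a) b c ▷ᵢ (as a (tUnit B) (b ⊠ c) ≫ a ◃ lu (b ⊠ c))
      ≪⊗≫ as a b c ◁ᵢ midUnit a (b ⊠ c)
      ≪⊗≫ Iso.refl (as a b c)
  /-- Unit coherence, with the unit in the third place. -/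
  assoc_rightUnit (a b c : B) :
    Iso.refl (as a b c ≫ a ◃ (ru b ▹ c) ≫ a ◃ as b (tUnit B) c ≫ a ◃ (b ◃ lu c))
      ≪⊗≫ as a b c ◁ᵢ tl30 a (midUnit b c)
      ≪⊗≫ Iso.refl (as a b c)
    = Iso.refl (as a b c ≫ a ◃ (ru b ▹ c) ≫ a ◃ as b (tUnit B) c ≫ a ◃ (b ◃ lu c))
      ≪⊗≫ (asN₂ a (ru b) c).symm ▷ᵢ (a ◃ as b (tUnit B) c ≫ a ◃ (b ◃ lu c))
      ≪⊗≫ tr12 (rightUnit a b) c ▷ᵢ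
        (as a (b ⊠ tUnit B) c ≫ a ◃ as b (tUnit B) c ≫ a ◃ (b ◃ lu c))
      ≪⊗≫ ru (a ⊠ b) ▹ c ◁ᵢ pent a b (tUnit B) c ▷ᵢ a ◃ (b ◃ lu c)
      ≪⊗≫ (ru (a ⊠ b) ▹ c ≫ as (a ⊠ b) (tUnit B) c) ◁ᵢ (asN₃ a b (lu c)).symm
      ≪⊗≫ midUnit (a ⊠ b) c ▷ᵢ as a b c
      ≪⊗≫ Iso.refl (as a b c)
  /-- Braiding one object past three others. -/
  braid_one_three (a b c d : B) :
    Iso.refl ((br a b ▹ c) ▹ d ≫ as b a c ▹ d ≫ (b ◃ br a c) ▹ d ≫ as b (c ⊠ a) d ≫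
        b ◃ as c a d ≫ b ◃ (c ◃ br a d))
      ≪⊗≫ (tr33 (hexR a b c) d).symm ▷ᵢ (as b (c ⊠ a) d ≫ b ◃ as c a d ≫ b ◃ (c ◃ br a d))
      ≪⊗≫ (as a b c ▹ d ≫ br a (b ⊠ c) ▹ d) ◁ᵢ pent b c a d ▷ᵢ b ◃ (c ◃ br a d)
      ≪⊗≫ (as a b c ▹ d ≫ br a (b ⊠ c) ▹ d ≫ as (b ⊠ c) a d) ◁ᵢ (asN₃ b c (br a d)).symm
      ≪⊗≫ as a b c ▹ d ◁ᵢ (hexR a (b ⊠ c) d).symm ▷ᵢ as b c (d ⊠ a)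
      ≪⊗≫ Iso.refl (as a b c ▹ d ≫ as a (b ⊠ c) d ≫ br a ((b ⊠ c) ⊠ d) ≫ as (b ⊠ c) d a ≫
        as b c (d ⊠ a))
    = Iso.refl ((br a b ▹ c) ▹ d ≫ as b a c ▹ d ≫ (b ◃ br a c) ▹ d ≫ as b (c ⊠ a) d ≫
        b ◃ as c a d ≫ b ◃ (c ◃ br a d))
      ≪⊗≫ ((br a b ▹ c) ▹ d ≫ as b a c ▹ d) ◁ᵢ asN₂ b (br a c) d ▷ᵢ
        (b ◃ as c a d ≫ b ◃ (c ◃ br a d))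
      ≪⊗≫ ((br a b ▹ c) ▹ d ≫ as b a c ▹ d ≫ as b (a ⊠ c) d) ◁ᵢ (tl33 b (hexR a c d)).symm
      ≪⊗≫ (br a b ▹ c) ▹ d ◁ᵢ pent b a c d ▷ᵢ (b ◃ br a (c ⊠ d) ≫ b ◃ as c d a)
      ≪⊗≫ asN₁ (br a b) c d ▷ᵢ (as b a (c ⊠ d) ≫ b ◃ br a (c ⊠ d) ≫ b ◃ as c d a)
      ≪⊗≫ as (a ⊠ b) c d ◁ᵢ (hexR a b (c ⊠ d)).symm ▷ᵢ b ◃ as c d a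
      ≪⊗≫ (pent a b c d).symm ▷ᵢ (br a (b ⊠ c ⊠ d) ≫ as b (c ⊠ d) a ≫ b ◃ as c d a)
      ≪⊗≫ (as a b c ▹ d ≫ as a (b ⊠ c) d) ◁ᵢ brN₂ a (as b c d) ▷ᵢ
        (as b (c ⊠ d) a ≫ b ◃ as c d a)
      ≪⊗≫ (as a b c ▹ d ≫ as a (b ⊠ c) d ≫ br a ((b ⊠ c) ⊠ d)) ◁ᵢ pent b c d a
      ≪⊗≫ Iso.refl (as a b c ▹ d ≫ as a (b ⊠ c) d ≫ br a ((b ⊠ c) ⊠ d) ≫ as (b ⊠ c) d a ≫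
        as b c (d ⊠ a))
  /-- Braiding three objects past one other. -/
  braid_three_one (a b c d : B) :
    Iso.refl (d ◃ (c ◃ br b a) ≫ d ◃ as' c a b ≫ d ◃ (br c a ▹ b) ≫ as' d (a ⊠ c) b ≫
        as' d a c ▹ b ≫ (br d a ▹ c) ▹ b)
      ≪⊗≫ (tl33 d (hexS c b a)).symm ▷ᵢ (as' d (a ⊠ c) b ≫ as' d a c ▹ b ≫ (br d a ▹ c) ▹ b)
      ≪⊗≫ (d ◃ as' c b a ≫ d ◃ br (c ⊠ b) a) ◁ᵢ pent' d a c b ▷ᵢ (br d a ▹ c) ▹ b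
      ≪⊗≫ (d ◃ as' c b a ≫ d ◃ br (c ⊠ b) a ≫ as' d a (c ⊠ b)) ◁ᵢ (asN₁' (br d a) c b).symm
      ≪⊗≫ d ◃ as' c b a ◁ᵢ (hexS d (c ⊠ b) a).symm ▷ᵢ as' (a ⊠ d) c b
      ≪⊗≫ Iso.refl (d ◃ as' c b a ≫ as' d (c ⊠ b) a ≫ br (d ⊠ c ⊠ b) a ≫ as' a d (c ⊠ b) ≫
        as' (a ⊠ d) c b)
    = Iso.refl (d ◃ (c ◃ br b a) ≫ d ◃ as' c a b ≫ d ◃ (br c a ▹ b) ≫ as' d (a ⊠ c) b ≫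
        as' d a c ▹ b ≫ (br d a ▹ c) ▹ b)
      ≪⊗≫ (d ◃ (c ◃ br b a) ≫ d ◃ as' c a b) ◁ᵢ asN₂' d (br c a) b ▷ᵢ
        (as' d a c ▹ b ≫ (br d a ▹ c) ▹ b)
      ≪⊗≫ (d ◃ (c ◃ br b a) ≫ d ◃ as' c a b ≫ as' d (c ⊠ a) b) ◁ᵢ (tr33 (hexS d c a) b).symm
      ≪⊗≫ d ◃ (c ◃ br b a) ◁ᵢ pent' d c a b ▷ᵢ (br (d ⊠ c) a ▹ b ≫ as' a d c ▹ b)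
      ≪⊗≫ asN₃' d c (br b a) ▷ᵢ (as' (d ⊠ c) a b ≫ br (d ⊠ c) a ▹ b ≫ as' a d c ▹ b)
      ≪⊗≫ as' d c (b ⊠ a) ◁ᵢ (hexS (d ⊠ c) b a).symm ▷ᵢ as' a d c ▹ b
      ≪⊗≫ (pent' d c b a).symm ▷ᵢ (br ((d ⊠ c) ⊠ b) a ≫ as' a (d ⊠ c) b ≫ as' a d c ▹ b)
      ≪⊗≫ (d ◃ as' c b a ≫ as' d (c ⊠ b) a) ◁ᵢ brN₁ (as' d c b) a ▷ᵢ
        (as' a (d ⊠ c) b ≫ as' a d c ▹ b)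
      ≪⊗≫ (d ◃ as' c b a ≫ as' d (c ⊠ b) a ≫ br (d ⊠ c ⊠ b) a) ◁ᵢ pent' a d c b
      ≪⊗≫ Iso.refl (d ◃ as' c b a ≫ as' d (c ⊠ b) a ≫ br (d ⊠ c ⊠ b) a ≫ as' a d (c ⊠ b) ≫
        as' (a ⊠ d) c b)
  /-- Braiding two objects past two others. -/
  braid_two_two (a b c d : B) :
    Iso.refl (br (a ⊠ b) (c ⊠ d))
      ≪⊗≫ hexR' (a ⊠ b) c d
      ≪⊗≫ as' (a ⊠ b) c d ◁ᵢ tr15 (hexS' a b c) d ▷ᵢ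
        (as c (a ⊠ b) d ≫ c ◃ br (a ⊠ b) d ≫ as' c d (a ⊠ b))
      ≪⊗≫ (as' (a ⊠ b) c d ≫ as a b c ▹ d ≫ (a ◃ br b c) ▹ d ≫ as' a c b ▹ d ≫
          (br a c ▹ b) ▹ d ≫ as c a b ▹ d ≫ as c (a ⊠ b) d) ◁ᵢ
        tl15 c (hexS' a b d) ▷ᵢ as' c d (a ⊠ b)
      ≪⊗≫ (as' (a ⊠ b) c d ≫ as a b c ▹ d ≫ (a ◃ br b c) ▹ d ≫ as' a c b ▹ d ≫
          (br a c ▹ b) ▹ d) ◁ᵢ pent c a b d ▷ᵢ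
        (c ◃ (a ◃ br b d) ≫ c ◃ as' a d b ≫ c ◃ (br a d ▹ b) ≫ c ◃ as d a b ≫ as' c d (a ⊠ b))
      ≪⊗≫ (as' (a ⊠ b) c d ≫ as a b c ▹ d ≫ (a ◃ br b c) ▹ d ≫ as' a c b ▹ d) ◁ᵢ
        asN₁ (br a c) b d ▷ᵢ
        (as c a (b ⊠ d) ≫ c ◃ (a ◃ br b d) ≫ c ◃ as' a d b ≫ c ◃ (br a d ▹ b) ≫
          c ◃ as d a b ≫ as' c d (a ⊠ b))
      ≪⊗≫ (as' (a ⊠ b) c d ≫ as a b c ▹ d ≫ (a ◃ br b c) ▹ d ≫ as' a c b ▹ d ≫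
          as (a ⊠ c) b d ≫ br a c ▹ (b ⊠ d)) ◁ᵢ (asN₃ c a (br b d)).symm ▷ᵢ
        (c ◃ as' a d b ≫ c ◃ (br a d ▹ b) ≫ c ◃ as d a b ≫ as' c d (a ⊠ b))
      ≪⊗≫ (as' (a ⊠ b) c d ≫ as a b c ▹ d) ◁ᵢ asUnit a (b ⊠ c) d ▷ᵢ
        ((a ◃ br b c) ▹ d ≫ as' a c b ▹ d ≫ as (a ⊠ c) b d ≫ br a c ▹ (b ⊠ d) ≫
          (c ⊠ a) ◃ br b d ≫ as c a (d ⊠ b) ≫ c ◃ as' a d b ≫ c ◃ (br a d ▹ b) ≫ c ◃ as d a b ≫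
          as' c d (a ⊠ b))
      ≪⊗≫ pentA a b c d ▷ᵢ
        (as' a (b ⊠ c) d ≫ (a ◃ br b c) ▹ d ≫ as' a c b ▹ d ≫ as (a ⊠ c) b d ≫
          br a c ▹ (b ⊠ d) ≫ (c ⊠ a) ◃ br b d ≫ as c a (d ⊠ b) ≫ c ◃ as' a d b ≫
          c ◃ (br a d ▹ b) ≫ c ◃ as d a b ≫ as' c d (a ⊠ b))
      ≪⊗≫ (as a b (c ⊠ d) ≫ a ◃ as' b c d) ◁ᵢ (asN₂' a (br b c) d).symm ▷ᵢ
        (as' a c b ▹ d ≫ as (a ⊠ c) b d ≫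
          br a c ▹ (b ⊠ d) ≫ (c ⊠ a) ◃ br b d ≫ as c a (d ⊠ b) ≫ c ◃ as' a d b ≫
          c ◃ (br a d ▹ b) ≫ c ◃ as d a b ≫ as' c d (a ⊠ b))
      ≪⊗≫ (as a b (c ⊠ d) ≫ a ◃ as' b c d ≫ a ◃ (br b c ▹ d)) ◁ᵢ pentB a c b d ▷ᵢ
        (br a c ▹ (b ⊠ d) ≫ (c ⊠ a) ◃ br b d ≫ as c a (d ⊠ b) ≫ c ◃ as' a d b ≫
          c ◃ (br a d ▹ b) ≫ c ◃ as d a b ≫ as' c d (a ⊠ b))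
      ≪⊗≫ (as a b (c ⊠ d) ≫ a ◃ as' b c d ≫ a ◃ (br b c ▹ d) ≫ a ◃ as c b d ≫ as' a c (b ⊠ d) ≫
          br a c ▹ (b ⊠ d) ≫ (c ⊠ a) ◃ br b d) ◁ᵢ (pentA c a d b).symm ▷ᵢ
        (c ◃ (br a d ▹ b) ≫ c ◃ as d a b ≫ as' c d (a ⊠ b))
      ≪⊗≫ (as a b (c ⊠ d) ≫ a ◃ as' b c d ≫ a ◃ (br b c ▹ d) ≫ a ◃ as c b d ≫ as' a c (b ⊠ d) ≫
          br a c ▹ (b ⊠ d) ≫ (c ⊠ a) ◃ br b d ≫ as' (c ⊠ a) d b ≫ as c a d ▹ b) ◁ᵢ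
        (asN₂ c (br a d) b).symm ▷ᵢ (c ◃ as d a b ≫ as' c d (a ⊠ b))
      ≪⊗≫ (as a b (c ⊠ d) ≫ a ◃ as' b c d ≫ a ◃ (br b c ▹ d) ≫ a ◃ as c b d ≫ as' a c (b ⊠ d) ≫
          br a c ▹ (b ⊠ d) ≫ (c ⊠ a) ◃ br b d ≫ as' (c ⊠ a) d b ≫ as c a d ▹ b ≫
          (c ◃ br a d) ▹ b) ◁ᵢ pentC c d a b
      ≪⊗≫ Iso.refl (as a b (c ⊠ d) ≫ a ◃ as' b c d ≫ a ◃ (br b c ▹ d) ≫ a ◃ as c b d ≫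
          as' a c (b ⊠ d) ≫ br a c ▹ (b ⊠ d) ≫ (c ⊠ a) ◃ br b d ≫ as' (c ⊠ a) d b ≫
          as c a d ▹ b ≫ (c ◃ br a d) ▹ b ≫ as' c d a ▹ b ≫ as (c ⊠ d) a b)
    = Iso.refl (br (a ⊠ b) (c ⊠ d))
      ≪⊗≫ hexS' a b (c ⊠ d)
      ≪⊗≫ as a b (c ⊠ d) ◁ᵢ tl15 a (hexR' b c d) ▷ᵢ
        (as' a (c ⊠ d) b ≫ br a (c ⊠ d) ▹ b ≫ as (c ⊠ d) a b)
      ≪⊗≫ (as a b (c ⊠ d) ≫ a ◃ as' b c d ≫ a ◃ (br b c ▹ d) ≫ a ◃ as c b d ≫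
          a ◃ (c ◃ br b d) ≫ a ◃ as' c d b ≫ as' a (c ⊠ d) b) ◁ᵢ
        tr15 (hexR' a c d) b ▷ᵢ as (c ⊠ d) a b
      ≪⊗≫ (as a b (c ⊠ d) ≫ a ◃ as' b c d ≫ a ◃ (br b c ▹ d) ≫ a ◃ as c b d ≫
          a ◃ (c ◃ br b d)) ◁ᵢ pent' a c d b ▷ᵢ
        ((br a c ▹ d) ▹ b ≫ as c a d ▹ b ≫ (c ◃ br a d) ▹ b ≫ as' c d a ▹ b ≫ as (c ⊠ d) a b)
      ≪⊗≫ (as a b (c ⊠ d) ≫ a ◃ as' b c d ≫ a ◃ (br b c ▹ d) ≫ a ◃ as c b d) ◁ᵢ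
        asN₃' a c (br b d) ▷ᵢ
        (as' (a ⊠ c) d b ≫ (br a c ▹ d) ▹ b ≫ as c a d ▹ b ≫ (c ◃ br a d) ▹ b ≫ as' c d a ▹ b ≫
          as (c ⊠ d) a b)
      ≪⊗≫ (as a b (c ⊠ d) ≫ a ◃ as' b c d ≫ a ◃ (br b c ▹ d) ≫ a ◃ as c b d ≫
          as' a c (b ⊠ d) ≫ (a ⊠ c) ◃ br b d) ◁ᵢ (asN₁' (br a c) d b).symm ▷ᵢ
        (as c a d ▹ b ≫ (c ◃ br a d) ▹ b ≫ as' c d a ▹ b ≫ as (c ⊠ d) a b)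
      ≪⊗≫ (as a b (c ⊠ d) ≫ a ◃ as' b c d ≫ a ◃ (br b c ▹ d) ≫ a ◃ as c b d ≫
          as' a c (b ⊠ d)) ◁ᵢ (inter (br a c) (br b d)).symm ▷ᵢ
        (as' (c ⊠ a) d b ≫ as c a d ▹ b ≫ (c ◃ br a d) ▹ b ≫ as' c d a ▹ b ≫ as (c ⊠ d) a b)
      ≪⊗≫ Iso.refl (as a b (c ⊠ d) ≫ a ◃ as' b c d ≫ a ◃ (br b c ▹ d) ≫ a ◃ as c b d ≫
          as' a c (b ⊠ d) ≫ br a c ▹ (b ⊠ d) ≫ (c ⊠ a) ◃ br b d ≫ as' (c ⊠ a) d b ≫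
          as c a d ▹ b ≫ (c ◃ br a d) ▹ b ≫ as' c d a ▹ b ≫ as (c ⊠ d) a b)
  /-- The two proofs of the Yang-Baxter relation agree. -/
  yang_baxter (a b c : B) :
    Iso.refl (br a b ▹ c ≫ as b a c ≫ b ◃ br a c ≫ as' b c a ≫ br b c ▹ a ≫ as c b a)
      ≪⊗≫ (hexR a b c).symm ▷ᵢ (as' b c a ≫ br b c ▹ a ≫ as c b a)
      ≪⊗≫ (as a b c ≫ br a (b ⊠ c)) ◁ᵢ (asUnit b c a).symm ▷ᵢ (br b c ▹ a ≫ as c b a)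
      ≪⊗≫ as a b c ◁ᵢ (brN₂ a (br b c)).symm ▷ᵢ as c b a
      ≪⊗≫ (as a b c ≫ a ◃ br b c) ◁ᵢ hexR' a c b ▷ᵢ as c b a
      ≪⊗≫ (as a b c ≫ a ◃ br b c ≫ as' a c b ≫ br a c ▹ b ≫ as c a b ≫ c ◃ br a b) ◁ᵢ
        asCounit c b a
      ≪⊗≫ Iso.refl (as a b c ≫ a ◃ br b c ≫ as' a c b ≫ br a c ▹ b ≫ as c a b ≫ c ◃ br a b)
    = Iso.refl (br a b ▹ c ≫ as b a c ≫ b ◃ br a c ≫ as' b c a ≫ br b c ▹ a ≫ as c b a)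
      ≪⊗≫ br a b ▹ c ◁ᵢ (hexS' b a c).symm
      ≪⊗≫ brN₁ (br a b) c
      ≪⊗≫ hexS' a b c ▷ᵢ c ◃ br a b
      ≪⊗≫ Iso.refl (as a b c ≫ a ◃ br b c ≫ as' a c b ≫ br a c ▹ b ≫ as c a b ≫ c ◃ br a b)
  /-- The syllepsis and the first hexagon modification. -/
  syll_right (a b c : B) :
    Iso.refl (𝟙 (a ⊠ b ⊠ c))
      ≪⊗≫ syll a (b ⊠ c)
      ≪⊗≫ hexR' a b c ▷ᵢ br (b ⊠ c) a
      ≪⊗≫ (as' a b c ≫ br a b ▹ c ≫ as b a c ≫ b ◃ br a c ≫ as' b c a) ◁ᵢ hexS' b c a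
      ≪⊗≫ (as' a b c ≫ br a b ▹ c ≫ as b a c ≫ b ◃ br a c) ◁ᵢ asCounit b c a ▷ᵢ
        (b ◃ br c a ≫ as' b a c ≫ br b a ▹ c ≫ as a b c)
      ≪⊗≫ (as' a b c ≫ br a b ▹ c ≫ as b a c) ◁ᵢ (tl02 b (syll a c)).symm ▷ᵢ
        (as' b a c ≫ br b a ▹ c ≫ as a b c)
      ≪⊗≫ (as' a b c ≫ br a b ▹ c) ◁ᵢ (asUnit b a c).symm ▷ᵢ (br b a ▹ c ≫ as a b c)
      ≪⊗≫ as' a b c ◁ᵢ (tr02 (syll a b) c).symm ▷ᵢ as a b c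
      ≪⊗≫ asCounit a b c
      ≪⊗≫ Iso.refl (𝟙 (a ⊠ b ⊠ c))
    = Iso.refl (𝟙 (a ⊠ b ⊠ c))
  /-- The syllepsis and the second hexagon modification. -/
  syll_left (a b c : B) :
    Iso.refl (𝟙 ((a ⊠ b) ⊠ c))
      ≪⊗≫ syll (a ⊠ b) c
      ≪⊗≫ hexS' a b c ▷ᵢ br c (a ⊠ b)
      ≪⊗≫ (as a b c ≫ a ◃ br b c ≫ as' a c b ≫ br a c ▹ b ≫ as c a b) ◁ᵢ hexR' c a b
      ≪⊗≫ (as a b c ≫ a ◃ br b c ≫ as' a c b ≫ br a c ▹ b) ◁ᵢ (asUnit c a b).symm ▷ᵢ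
        (br c a ▹ b ≫ as a c b ≫ a ◃ br c b ≫ as' a b c)
      ≪⊗≫ (as a b c ≫ a ◃ br b c ≫ as' a c b) ◁ᵢ (tr02 (syll a c) b).symm ▷ᵢ
        (as a c b ≫ a ◃ br c b ≫ as' a b c)
      ≪⊗≫ (as a b c ≫ a ◃ br b c) ◁ᵢ asCounit a c b ▷ᵢ (a ◃ br c b ≫ as' a b c)
      ≪⊗≫ as a b c ◁ᵢ (tl02 a (syll b c)).symm ▷ᵢ as' a b c
      ≪⊗≫ (asUnit a b c).symm
      ≪⊗≫ Iso.refl (𝟙 ((a ⊠ b) ⊠ c))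
    = Iso.refl (𝟙 ((a ⊠ b) ⊠ c))
  /-- The syllepsis is symmetric. -/
  syll_symm (a b : B) :
    Iso.refl (br a b) ≪⊗≫ syll a b ▷ᵢ br a b ≪⊗≫ Iso.refl (br a b ≫ br b a ≫ br a b)
    = Iso.refl (br a b) ≪⊗≫ br a b ◁ᵢ syll b a ≪⊗≫ Iso.refl (br a b ≫ br b a ≫ br a b)

/-! ### Symmetric monoidal 2-functors -/

section Functors

variable {C : Type u₁} [Bicategory.{w₁, v₁} C] {D : Type u₂} [Bicategory.{w₂, v₂} D]

section Chi

variable [TensorBicategory C] [TensorBicategory D]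

/-- Natural 2-transformations `H(-) ⊗ H(-) ⟹ H(- ⊗ -)` which are adjoint equivalences. -/
abbrev ChiEquiv (H : C ⥤ᵖ D) :=
  (pairP ((fstP C C).comp H) ((sndP C C).comp H)).comp TensorBicategory.tensor ≌
    TensorBicategory.tensor.comp H

variable {H : C ⥤ᵖ D}

/-- The components `H a ⊗ H b ⟶ H (a ⊗ b)`. -/
def ChiEquiv.at (χ : ChiEquiv H) (a b : C) : H.obj a ⊠ H.obj b ⟶ H.obj (a ⊠ b) :=
  χ.hom.app (a, b)

/-- The naturality 2-morphisms of `ChiEquiv.at`. -/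
def ChiEquiv.nat (χ : ChiEquiv H) {a a' b b' : C} (f : a ⟶ a') (g : b ⟶ b') :
    H.map f ⊠₁ H.map g ≫ χ.at a' b' ≅ χ.at a b ≫ H.map (f ⊠₁ g) :=
  χ.hom.naturality (a := (a, b)) (b := (a', b')) (f, g)

/-- Naturality of `ChiEquiv.at` in the first variable. -/
def ChiEquiv.nat₁ (χ : ChiEquiv H) {a a' : C} (f : a ⟶ a') (b : C) :
    H.map f ▹ H.obj b ≫ χ.at a' b ≅ χ.at a b ≫ H.map (f ▹ b) :=
  tIso (Iso.refl (H.map f)) (H.mapId b).symm ▷ᵢ χ.at a' b ≪≫ χ.nat f (𝟙 b)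

/-- Naturality of `ChiEquiv.at` in the second variable. -/
def ChiEquiv.nat₂ (χ : ChiEquiv H) (a : C) {b b' : C} (g : b ⟶ b') :
    H.obj a ◃ H.map g ≫ χ.at a b' ≅ χ.at a b ≫ H.map (a ◃ g) :=
  tIso (H.mapId a).symm (Iso.refl (H.map g)) ▷ᵢ χ.at a b' ≪≫ χ.nat (𝟙 a) g

end Chi

section Cells

variable {X : Type u} [Quiver.{v} X]

/-- The diagram of objects and 1-morphisms underlying a pseudofunctor. -/
def preP (H : C ⥤ᵖ D) : C ⥤q D where
  obj := H.obj
  map := H.map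

/-- A pseudofunctor applied to a natural 2-transformation. -/
def Cells.mapC (H : C ⥤ᵖ D) {F G : X ⥤q C} (σ : Cells F G) : Cells (F ⋙q preP H) (G ⋙q preP H) where
  app x := H.map (σ.app x)
  cell {x y} f := (H.mapComp (σ.app x) (G.map f)).inv ≫ H.map₂ (σ.cell f) ≫
    (H.mapComp (F.map f) (σ.app y)).hom

variable [TensorBicategory C] [TensorBicategory D] {H : C ⥤ᵖ D}

/-- The transformation `H(-) ⊗ H(-) ⟹ H(- ⊗ -)`. -/
def Cells.chiC (χ : ChiEquiv H) (P Q : X ⥤q C) :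
    Cells ((P ⋙q preP H) ⊠q (Q ⋙q preP H)) ((P ⊠q Q) ⋙q preP H) where
  app x := χ.at (P.obj x) (Q.obj x)
  cell f := (χ.nat (P.map f) (Q.map f)).inv

/-- The 1-morphism `1 ⟶ H 1` as a natural 2-transformation. -/
def Cells.iotaC (ι : tUnit D ≌ H.obj (tUnit C)) : Cells (unitPre X D) (unitPre X C ⋙q preP H) where
  app _ := ι.hom
  cell _ := ι.hom ◁ (H.mapId (tUnit C)).hom ≫ (ρ_ ι.hom).hom ≫ (λ_ ι.hom).inv

end Cells

/-- The data of a symmetric monoidal 2-functor: a 2-functor with adjoint equivalences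
`H a ⊗ H b ⟶ H (a ⊗ b)` and `1 ⟶ H 1` and invertible modifications. -/
structure SymMonFunctorData [TensorBicategory C] [TensorBicategory D] (H : C ⥤ᵖ D) where
  χ : ChiEquiv H
  ι : tUnit D ≌ H.obj (tUnit C)
  modOmega (a b c : C) :
    χ.at a b ▹ H.obj c ≫ χ.at (a ⊠ b) c ≫ H.map (as a b c) ≅
      as (H.obj a) (H.obj b) (H.obj c) ≫ H.obj a ◃ χ.at b c ≫ χ.at a (b ⊠ c)
  modOmega_mod : IsModification
    ((Cells.chiC χ (q₁ C) (q₂ C) ⊠c Cells.id (q₃ C ⋙q preP H)) ⋙c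
      Cells.chiC χ (q₁ C ⊠q q₂ C) (q₃ C) ⋙c Cells.mapC H (Cells.asC (q₁ C) (q₂ C) (q₃ C)))
    (Cells.asC (q₁ C ⋙q preP H) (q₂ C ⋙q preP H) (q₃ C ⋙q preP H) ⋙c
      (Cells.id (q₁ C ⋙q preP H) ⊠c Cells.chiC χ (q₂ C) (q₃ C)) ⋙c
        Cells.chiC χ (q₁ C) (q₂ C ⊠q q₃ C))
    (fun x => (modOmega x.1 x.2.1 x.2.2).hom)
  modGamma (a : C) :
    ι.hom ▹ H.obj a ≫ χ.at (tUnit C) a ≫ H.map (lu a) ≅ lu (H.obj a)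
  modGamma_mod : IsModification
    ((Cells.iotaC ι ⊠c Cells.id (𝟭q C ⋙q preP H)) ⋙c Cells.chiC χ (unitPre C C) (𝟭q C) ⋙c
      Cells.mapC H (Cells.luC (𝟭q C)))
    (Cells.luC (𝟭q C ⋙q preP H))
    (fun x => (modGamma x).hom)
  modDelta (a : C) :
    H.map (ru a) ≅ ru (H.obj a) ≫ H.obj a ◃ ι.hom ≫ χ.at a (tUnit C)
  modDelta_mod : IsModification
    (Cells.mapC H (Cells.ruC (𝟭q C)))
    (Cells.ruC (𝟭q C ⋙q preP H) ⋙c (Cells.id (𝟭q C ⋙q preP H) ⊠c Cells.iotaC ι) ⋙c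
      Cells.chiC χ (𝟭q C) (unitPre C C))
    (fun x => (modDelta x).hom)
  modUpsilon (a b : C) :
    χ.at a b ≫ H.map (br a b) ≅ br (H.obj a) (H.obj b) ≫ χ.at b a
  modUpsilon_mod : IsModification
    (Cells.chiC χ (p₁ C) (p₂ C) ⋙c Cells.mapC H (Cells.brC (p₁ C) (p₂ C)))
    (Cells.brC (p₁ C ⋙q preP H) (p₂ C ⋙q preP H) ⋙c Cells.chiC χ (p₂ C) (p₁ C))
    (fun x => (modUpsilon x.1 x.2).hom)

section MapIso

variable (H : C ⥤ᵖ D) {a a' a₁ a₂ a₃ a₄ : C} {f₁ : a ⟶ a₁} {f₂ : a₁ ⟶ a₂}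

/-- Apply a 2-functor to an isomorphism `f₁ ≫ f₂ ≫ f₃ ≅ g₁ ≫ g₂`. -/
def mp32 {f₃ : a₂ ⟶ a'} {g₁ : a ⟶ a₃} {g₂ : a₃ ⟶ a'} (η : f₁ ≫ f₂ ≫ f₃ ≅ g₁ ≫ g₂) :
    H.map f₁ ≫ H.map f₂ ≫ H.map f₃ ≅ H.map g₁ ≫ H.map g₂ :=
  H.map f₁ ◁ᵢ (H.mapComp f₂ f₃).symm ≪≫ (H.mapComp f₁ (f₂ ≫ f₃)).symm ≪≫ H.map₂Iso η ≪≫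
    H.mapComp g₁ g₂

/-- Apply a 2-functor to an isomorphism `f₁ ≫ f₂ ≫ f₃ ≅ g₁ ≫ g₂ ≫ g₃`. -/
def mp33 {f₃ : a₂ ⟶ a'} {g₁ : a ⟶ a₃} {g₂ : a₃ ⟶ a₄} {g₃ : a₄ ⟶ a'}
    (η : f₁ ≫ f₂ ≫ f₃ ≅ g₁ ≫ g₂ ≫ g₃) :
    H.map f₁ ≫ H.map f₂ ≫ H.map f₃ ≅ H.map g₁ ≫ H.map g₂ ≫ H.map g₃ :=
  H.map f₁ ◁ᵢ (H.mapComp f₂ f₃).symm ≪≫ (H.mapComp f₁ (f₂ ≫ f₃)).symm ≪≫ H.map₂Iso η ≪≫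
    H.mapComp g₁ (g₂ ≫ g₃) ≪≫ H.map g₁ ◁ᵢ H.mapComp g₂ g₃

/-- Apply a 2-functor to an isomorphism `f₁ ≫ f₂ ≫ f₃ ≅ 𝟙`. -/
def mp30 {f₃ : a₂ ⟶ a} (η : f₁ ≫ f₂ ≫ f₃ ≅ 𝟙 a) :
    H.map f₁ ≫ H.map f₂ ≫ H.map f₃ ≅ 𝟙 (H.obj a) :=
  H.map f₁ ◁ᵢ (H.mapComp f₂ f₃).symm ≪≫ (H.mapComp f₁ (f₂ ≫ f₃)).symm ≪≫ H.map₂Iso η ≪≫ H.mapId a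

/-- Apply a 2-functor to an isomorphism `𝟙 ≅ f ≫ g`. -/
def mp02 {f : a ⟶ a'} {g : a' ⟶ a} (η : 𝟙 a ≅ f ≫ g) :
    𝟙 (H.obj a) ≅ H.map f ≫ H.map g :=
  (H.mapId a).symm ≪≫ H.map₂Iso η ≪≫ H.mapComp f g

end MapIso

section

variable [SymMonData C] [SymMonData D] {H : C ⥤ᵖ D}

/-- The mate of the modification `modOmega` for the inverse associators. -/
def SymMonFunctorData.modOmega' (h : SymMonFunctorData H) (a b c : C) :
    H.obj a ◃ h.χ.at b c ≫ h.χ.at a (b ⊠ c) ≫ H.map (as' a b c) ≅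
      as' (H.obj a) (H.obj b) (H.obj c) ≫ h.χ.at a b ▹ H.obj c ≫ h.χ.at (a ⊠ b) c :=
  Iso.refl _
  ≪⊗≫ (asCounit (H.obj a) (H.obj b) (H.obj c)).symm ▷ᵢ
    (H.obj a ◃ h.χ.at b c ≫ h.χ.at a (b ⊠ c) ≫ H.map (as' a b c))
  ≪⊗≫ as' (H.obj a) (H.obj b) (H.obj c) ◁ᵢ (h.modOmega a b c).symm ▷ᵢ H.map (as' a b c)
  ≪⊗≫ (as' (H.obj a) (H.obj b) (H.obj c) ≫ h.χ.at a b ▹ H.obj c ≫ h.χ.at (a ⊠ b) c) ◁ᵢ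
    (mp02 H (asUnit a b c)).symm
  ≪⊗≫ Iso.refl _

open SymMonData

/-- Symmetric monoidal structures on a 2-functor. Each law states that two composites of the
structure 2-morphisms agree. -/
structure SymMonFunctor (H : C ⥤ᵖ D) extends SymMonFunctorData H where
  /-- Compatibility with the pentagon modifications. -/
  associativity (a b c d : C) :
    Iso.refl ((χ.at a b ▹ H.obj c) ▹ H.obj d ≫ χ.at (a ⊠ b) c ▹ H.obj d ≫ χ.at ((a ⊠ b) ⊠ c) d ≫
        H.map (as a b c ▹ d) ≫ H.map (as a (b ⊠ c) d) ≫ H.map (a ◃ as b c d))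
      ≪⊗≫ ((χ.at a b ▹ H.obj c) ▹ H.obj d ≫ χ.at (a ⊠ b) c ▹ H.obj d ≫ χ.at ((a ⊠ b) ⊠ c) d) ◁ᵢ
        mp32 H (pent a b c d)
      ≪⊗≫ (χ.at a b ▹ H.obj c) ▹ H.obj d ◁ᵢ modOmega (a ⊠ b) c d ▷ᵢ H.map (as a b (c ⊠ d))
      ≪⊗≫ asN₁ (χ.at a b) (H.obj c) (H.obj d) ▷ᵢ
        (H.obj (a ⊠ b) ◃ χ.at c d ≫ χ.at (a ⊠ b) (c ⊠ d) ≫ H.map (as a b (c ⊠ d)))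
      ≪⊗≫ as (H.obj a ⊠ H.obj b) (H.obj c) (H.obj d) ◁ᵢ inter (χ.at a b) (χ.at c d) ▷ᵢ
        (χ.at (a ⊠ b) (c ⊠ d) ≫ H.map (as a b (c ⊠ d)))
      ≪⊗≫ (as (H.obj a ⊠ H.obj b) (H.obj c) (H.obj d) ≫ (H.obj a ⊠ H.obj b) ◃ χ.at c d) ◁ᵢ
        modOmega a b (c ⊠ d)
      ≪⊗≫ as (H.obj a ⊠ H.obj b) (H.obj c) (H.obj d) ◁ᵢ asN₃ (H.obj a) (H.obj b) (χ.at c d) ▷ᵢ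
        (H.obj a ◃ χ.at b (c ⊠ d) ≫ χ.at a (b ⊠ c ⊠ d))
      ≪⊗≫ Iso.refl (as (H.obj a ⊠ H.obj b) (H.obj c) (H.obj d) ≫
        as (H.obj a) (H.obj b) (H.obj c ⊠ H.obj d) ≫ H.obj a ◃ (H.obj b ◃ χ.at c d) ≫
        H.obj a ◃ χ.at b (c ⊠ d) ≫ χ.at a (b ⊠ c ⊠ d))
    = Iso.refl ((χ.at a b ▹ H.obj c) ▹ H.obj d ≫ χ.at (a ⊠ b) c ▹ H.obj d ≫ χ.at ((a ⊠ b) ⊠ c) d ≫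
        H.map (as a b c ▹ d) ≫ H.map (as a (b ⊠ c) d) ≫ H.map (a ◃ as b c d))
      ≪⊗≫ ((χ.at a b ▹ H.obj c) ▹ H.obj d ≫ χ.at (a ⊠ b) c ▹ H.obj d) ◁ᵢ
        (χ.nat₁ (as a b c) d).symm ▷ᵢ (H.map (as a (b ⊠ c) d) ≫ H.map (a ◃ as b c d))
      ≪⊗≫ tr33 (modOmega a b c) (H.obj d) ▷ᵢ
        (χ.at (a ⊠ b ⊠ c) d ≫ H.map (as a (b ⊠ c) d) ≫ H.map (a ◃ as b c d))
      ≪⊗≫ (as (H.obj a) (H.obj b) (H.obj c) ▹ H.obj d ≫ (H.obj a ◃ χ.at b c) ▹ H.obj d) ◁ᵢ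
        modOmega a (b ⊠ c) d ▷ᵢ H.map (a ◃ as b c d)
      ≪⊗≫ as (H.obj a) (H.obj b) (H.obj c) ▹ H.obj d ◁ᵢ asN₂ (H.obj a) (χ.at b c) (H.obj d) ▷ᵢ
        (H.obj a ◃ χ.at (b ⊠ c) d ≫ χ.at a ((b ⊠ c) ⊠ d) ≫ H.map (a ◃ as b c d))
      ≪⊗≫ (as (H.obj a) (H.obj b) (H.obj c) ▹ H.obj d ≫ as (H.obj a) (H.obj b ⊠ H.obj c) (H.obj d) ≫
        H.obj a ◃ (χ.at b c ▹ H.obj d) ≫ H.obj a ◃ χ.at (b ⊠ c) d) ◁ᵢ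
        (χ.nat₂ a (as b c d)).symm
      ≪⊗≫ (as (H.obj a) (H.obj b) (H.obj c) ▹ H.obj d ≫ as (H.obj a) (H.obj b ⊠ H.obj c) (H.obj d))
        ◁ᵢ tl33 (H.obj a) (modOmega b c d) ▷ᵢ χ.at a (b ⊠ c ⊠ d)
      ≪⊗≫ pent (H.obj a) (H.obj b) (H.obj c) (H.obj d) ▷ᵢ
        (H.obj a ◃ (H.obj b ◃ χ.at c d) ≫ H.obj a ◃ χ.at b (c ⊠ d) ≫ χ.at a (b ⊠ c ⊠ d))
      ≪⊗≫ Iso.refl (as (H.obj a ⊠ H.obj b) (H.obj c) (H.obj d) ≫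
        as (H.obj a) (H.obj b) (H.obj c ⊠ H.obj d) ≫ H.obj a ◃ (H.obj b ◃ χ.at c d) ≫
        H.obj a ◃ χ.at b (c ⊠ d) ≫ χ.at a (b ⊠ c ⊠ d))
  /-- Compatibility with the middle unit modifications. -/
  unitality (a b : C) :
    Iso.refl (ru (H.obj a) ▹ H.obj b ≫ (H.obj a ◃ ι.hom) ▹ H.obj b ≫ χ.at a (tUnit C) ▹ H.obj b ≫
        χ.at (a ⊠ tUnit C) b ≫ H.map (as a (tUnit C) b) ≫ H.map (a ◃ lu b))
      ≪⊗≫ (isoR (modDelta a) (H.obj b) ≪≫ wr3 _ _ _ _).symm ▷ᵢ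
        (χ.at (a ⊠ tUnit C) b ≫ H.map (as a (tUnit C) b) ≫ H.map (a ◃ lu b))
      ≪⊗≫ χ.nat₁ (ru a) b ▷ᵢ (H.map (as a (tUnit C) b) ≫ H.map (a ◃ lu b))
      ≪⊗≫ χ.at a b ◁ᵢ mp30 H (midUnit a b)
      ≪⊗≫ Iso.refl (χ.at a b)
    = Iso.refl (ru (H.obj a) ▹ H.obj b ≫ (H.obj a ◃ ι.hom) ▹ H.obj b ≫
        χ.at a (tUnit C) ▹ H.obj b ≫
        χ.at (a ⊠ tUnit C) b ≫ H.map (as a (tUnit C) b) ≫ H.map (a ◃ lu b))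
      ≪⊗≫ (ru (H.obj a) ▹ H.obj b ≫ (H.obj a ◃ ι.hom) ▹ H.obj b) ◁ᵢ modOmega a (tUnit C) b ▷ᵢ
        H.map (a ◃ lu b)
      ≪⊗≫ (ru (H.obj a) ▹ H.obj b ≫ (H.obj a ◃ ι.hom) ▹ H.obj b ≫
        as (H.obj a) (H.obj (tUnit C)) (H.obj b) ≫ H.obj a ◃ χ.at (tUnit C) b) ◁ᵢ
        (χ.nat₂ a (lu b)).symm
      ≪⊗≫ ru (H.obj a) ▹ H.obj b ◁ᵢ asN₂ (H.obj a) ι.hom (H.obj b) ▷ᵢ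
        (H.obj a ◃ χ.at (tUnit C) b ≫ H.obj a ◃ H.map (lu b) ≫ χ.at a b)
      ≪⊗≫ (ru (H.obj a) ▹ H.obj b ≫ as (H.obj a) (tUnit D) (H.obj b)) ◁ᵢ
        ((wl3 _ _ _ _).symm ≪≫ isoL (H.obj a) (modGamma b)) ▷ᵢ χ.at a b
      ≪⊗≫ midUnit (H.obj a) (H.obj b) ▷ᵢ χ.at a b
      ≪⊗≫ Iso.refl (χ.at a b)
  /-- Compatibility with the first hexagon modifications. -/
  braiding_right (a b c : C) :
    Iso.refl (χ.at a b ▹ H.obj c ≫ χ.at (a ⊠ b) c ≫ H.map (as a b c) ≫ H.map (br a (b ⊠ c)) ≫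
        H.map (as b c a))
      ≪⊗≫ modOmega a b c ▷ᵢ (H.map (br a (b ⊠ c)) ≫ H.map (as b c a))
      ≪⊗≫ (as (H.obj a) (H.obj b) (H.obj c) ≫ H.obj a ◃ χ.at b c) ◁ᵢ modUpsilon a (b ⊠ c) ▷ᵢ
        H.map (as b c a)
      ≪⊗≫ as (H.obj a) (H.obj b) (H.obj c) ◁ᵢ brN₂ (H.obj a) (χ.at b c) ▷ᵢ
        (χ.at (b ⊠ c) a ≫ H.map (as b c a))
      ≪⊗≫ (as (H.obj a) (H.obj b) (H.obj c) ≫ br (H.obj a) (H.obj b ⊠ H.obj c)) ◁ᵢ modOmega b c a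
      ≪⊗≫ hexR (H.obj a) (H.obj b) (H.obj c) ▷ᵢ (H.obj b ◃ χ.at c a ≫ χ.at b (c ⊠ a))
      ≪⊗≫ Iso.refl (br (H.obj a) (H.obj b) ▹ H.obj c ≫ as (H.obj b) (H.obj a) (H.obj c) ≫
        H.obj b ◃ br (H.obj a) (H.obj c) ≫ H.obj b ◃ χ.at c a ≫ χ.at b (c ⊠ a))
    = Iso.refl (χ.at a b ▹ H.obj c ≫ χ.at (a ⊠ b) c ≫ H.map (as a b c) ≫ H.map (br a (b ⊠ c)) ≫
        H.map (as b c a))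
      ≪⊗≫ (χ.at a b ▹ H.obj c ≫ χ.at (a ⊠ b) c) ◁ᵢ mp33 H (hexR a b c)
      ≪⊗≫ χ.at a b ▹ H.obj c ◁ᵢ (χ.nat₁ (br a b) c).symm ▷ᵢ
        (H.map (as b a c) ≫ H.map (b ◃ br a c))
      ≪⊗≫ tr22 (modUpsilon a b) (H.obj c) ▷ᵢ
        (χ.at (b ⊠ a) c ≫ H.map (as b a c) ≫ H.map (b ◃ br a c))
      ≪⊗≫ br (H.obj a) (H.obj b) ▹ H.obj c ◁ᵢ modOmega b a c ▷ᵢ H.map (b ◃ br a c)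
      ≪⊗≫ (br (H.obj a) (H.obj b) ▹ H.obj c ≫ as (H.obj b) (H.obj a) (H.obj c) ≫
        H.obj b ◃ χ.at a c) ◁ᵢ (χ.nat₂ b (br a c)).symm
      ≪⊗≫ (br (H.obj a) (H.obj b) ▹ H.obj c ≫ as (H.obj b) (H.obj a) (H.obj c)) ◁ᵢ
        tl22 (H.obj b) (modUpsilon a c) ▷ᵢ χ.at b (c ⊠ a)
      ≪⊗≫ Iso.refl (br (H.obj a) (H.obj b) ▹ H.obj c ≫ as (H.obj b) (H.obj a) (H.obj c) ≫
        H.obj b ◃ br (H.obj a) (H.obj c) ≫ H.obj b ◃ χ.at c a ≫ χ.at b (c ⊠ a))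
  /-- Compatibility with the second hexagon modifications. -/
  braiding_left (a b c : C) :
    Iso.refl (H.obj a ◃ χ.at b c ≫ χ.at a (b ⊠ c) ≫ H.map (as' a b c) ≫ H.map (br (a ⊠ b) c) ≫
        H.map (as' c a b))
      ≪⊗≫ toSymMonFunctorData.modOmega' a b c ▷ᵢ (H.map (br (a ⊠ b) c) ≫ H.map (as' c a b))
      ≪⊗≫ (as' (H.obj a) (H.obj b) (H.obj c) ≫ χ.at a b ▹ H.obj c) ◁ᵢ modUpsilon (a ⊠ b) c ▷ᵢ
        H.map (as' c a b)
      ≪⊗≫ as' (H.obj a) (H.obj b) (H.obj c) ◁ᵢ brN₁ (χ.at a b) (H.obj c) ▷ᵢ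
        (χ.at c (a ⊠ b) ≫ H.map (as' c a b))
      ≪⊗≫ (as' (H.obj a) (H.obj b) (H.obj c) ≫ br (H.obj a ⊠ H.obj b) (H.obj c)) ◁ᵢ
        toSymMonFunctorData.modOmega' c a b
      ≪⊗≫ hexS (H.obj a) (H.obj b) (H.obj c) ▷ᵢ (χ.at c a ▹ H.obj b ≫ χ.at (c ⊠ a) b)
      ≪⊗≫ Iso.refl (H.obj a ◃ br (H.obj b) (H.obj c) ≫ as' (H.obj a) (H.obj c) (H.obj b) ≫
        br (H.obj a) (H.obj c) ▹ H.obj b ≫ χ.at c a ▹ H.obj b ≫ χ.at (c ⊠ a) b)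
    = Iso.refl (H.obj a ◃ χ.at b c ≫ χ.at a (b ⊠ c) ≫ H.map (as' a b c) ≫ H.map (br (a ⊠ b) c) ≫
        H.map (as' c a b))
      ≪⊗≫ (H.obj a ◃ χ.at b c ≫ χ.at a (b ⊠ c)) ◁ᵢ mp33 H (hexS a b c)
      ≪⊗≫ H.obj a ◃ χ.at b c ◁ᵢ (χ.nat₂ a (br b c)).symm ▷ᵢ
        (H.map (as' a c b) ≫ H.map (br a c ▹ b))
      ≪⊗≫ tl22 (H.obj a) (modUpsilon b c) ▷ᵢ
        (χ.at a (c ⊠ b) ≫ H.map (as' a c b) ≫ H.map (br a c ▹ b))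
      ≪⊗≫ H.obj a ◃ br (H.obj b) (H.obj c) ◁ᵢ toSymMonFunctorData.modOmega' a c b ▷ᵢ H.map (br a c ▹ b)
      ≪⊗≫ (H.obj a ◃ br (H.obj b) (H.obj c) ≫ as' (H.obj a) (H.obj c) (H.obj b) ≫
        χ.at a c ▹ H.obj b) ◁ᵢ (χ.nat₁ (br a c) b).symm
      ≪⊗≫ (H.obj a ◃ br (H.obj b) (H.obj c) ≫ as' (H.obj a) (H.obj c) (H.obj b)) ◁ᵢ
        tr22 (modUpsilon a c) (H.obj b) ▷ᵢ χ.at (c ⊠ a) b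
      ≪⊗≫ Iso.refl (H.obj a ◃ br (H.obj b) (H.obj c) ≫ as' (H.obj a) (H.obj c) (H.obj b) ≫
        br (H.obj a) (H.obj c) ▹ H.obj b ≫ χ.at c a ▹ H.obj b ≫ χ.at (c ⊠ a) b)
  /-- Compatibility with the syllepses. -/
  symmetry (a b : C) :
    Iso.refl (χ.at a b)
      ≪⊗≫ χ.at a b ◁ᵢ mp02 H (syll a b)
      ≪⊗≫ modUpsilon a b ▷ᵢ H.map (br b a)
      ≪⊗≫ br (H.obj a) (H.obj b) ◁ᵢ modUpsilon b a
      ≪⊗≫ Iso.refl (br (H.obj a) (H.obj b) ≫ br (H.obj b) (H.obj a) ≫ χ.at a b)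
    = Iso.refl (χ.at a b)
      ≪⊗≫ syll (H.obj a) (H.obj b) ▷ᵢ χ.at a b
      ≪⊗≫ Iso.refl (br (H.obj a) (H.obj b) ≫ br (H.obj b) (H.obj a) ≫ χ.at a b)

end

end Functors

/-! ### Natural symmetric monoidal 2-transformations between truncated 2-functors -/

section Squares

variable {B : Type u} [Bicategory.{w, v} B] [TensorBicategory B]
  {a a₁ a₂ a' b b₁ b' : B}

/-- Tensor a square with a 1-morphism on the right. -/
def sqR {f₁ : a ⟶ a₁} {f₂ : a₁ ⟶ a'} {g₁ : a ⟶ a₂} {g₂ : a₂ ⟶ a'} (η : f₁ ≫ f₂ ≅ g₁ ≫ g₂)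
    (t : b ⟶ b') : f₁ ⊠₁ t ≫ f₂ ▹ b' ≅ g₁ ▹ b ≫ g₂ ⊠₁ t :=
  (tComp f₁ f₂ t (𝟙 b')).symm ≪≫ tIso η (ρ_ t ≪≫ (λ_ t).symm) ≪≫ tComp g₁ g₂ (𝟙 b) t

/-- Tensor a square with a 1-morphism on the left. -/
def sqL (t : b ⟶ b') {f₁ : a ⟶ a₁} {f₂ : a₁ ⟶ a'} {g₁ : a ⟶ a₂} {g₂ : a₂ ⟶ a'}
    (η : f₁ ≫ f₂ ≅ g₁ ≫ g₂) : t ⊠₁ f₁ ≫ b' ◃ f₂ ≅ b ◃ g₁ ≫ t ⊠₁ g₂ :=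
  (tComp t (𝟙 b') f₁ f₂).symm ≪≫ tIso (ρ_ t ≪≫ (λ_ t).symm) η ≪≫ tComp (𝟙 b) t g₁ g₂

/-- Tensor a triangle with a 1-morphism on the right. -/
def triR {k : a ⟶ a'} {i : a ⟶ a₁} {s : a₁ ⟶ a'} (η : k ≅ i ≫ s) (t : b ⟶ b') :
    i ▹ b ≫ s ⊠₁ t ≅ a ◃ t ≫ k ▹ b' :=
  (tComp i s (𝟙 b) t).symm ≪≫ tIso η.symm (λ_ t) ≪≫ splitLR k t

/-- Tensor a triangle with a 1-morphism on the left. -/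
def triL (t : b ⟶ b') {k : a ⟶ a'} {i : a ⟶ a₁} {s : a₁ ⟶ a'} (η : k ≅ i ≫ s) :
    t ▹ a ≫ b' ◃ k ≅ b ◃ i ≫ t ⊠₁ s :=
  (splitRL t k).symm ≪≫ tIso (λ_ t).symm η ≪≫ tComp (𝟙 b) t i s

end Squares

section Transformations

variable {C : Type u₁} [Bicategory.{w₁, v₁} C] {D : Type u₂} [Bicategory.{w₂, v₂} D]

/-- The truncation of a 2-functor: its restriction to the sub-bicategory with the same objects and
1-morphisms, and only the invertible 2-morphisms. -/
abbrev trunc (H : C ⥤ᵖ D) : (Pith C) ⥤ᵖ D := (Pith.inclusion C).comp H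

/-- Natural 2-transformations between truncated 2-functors. They consist of 1-morphisms
`θ_a : H a ⟶ K a` and of 2-morphisms `θ_a ≫ K f ⟶ H f ≫ θ_b` which need not be invertible. -/
abbrev TrTrans (H K : C ⥤ᵖ D) := Lax.LaxTrans (trunc H).toLax (trunc K).toLax

variable {H K : C ⥤ᵖ D}

/-- The components of a natural 2-transformation. -/
def TrTrans.at (θ : TrTrans H K) (a : C) : H.obj a ⟶ K.obj a := θ.app ⟨a⟩

/-- The naturality 2-morphisms of a natural 2-transformation. -/
def TrTrans.nat (θ : TrTrans H K) {a b : C} (f : a ⟶ b) :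
    TrTrans.at θ a ≫ K.map f ⟶ H.map f ≫ TrTrans.at θ b :=
  θ.naturality (a := ⟨a⟩) (b := ⟨b⟩) ⟨f⟩

/-- The restriction of a natural 2-transformation along a diagram in `C`. -/
def Cells.transC {X : Type u} [Quiver.{v} X] (θ : TrTrans H K) (P : X ⥤q C) :
    Cells (P ⋙q preP H) (P ⋙q preP K) where
  app x := TrTrans.at θ (P.obj x)
  cell f := TrTrans.nat θ (P.map f)

/-- A natural symmetric monoidal 2-transformation from `tr H` to `tr K`: a natural 2-transformation
together with invertible modifications `modPi` and `modM`, compatible with the structure 2-morphisms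
`modOmega`, `modGamma`, `modDelta` and `modUpsilon` of the two symmetric monoidal 2-functors. All structure
2-morphisms of `C` are invertible, so that they belong to the truncation of `C`. -/
structure TrSymMonTrans [SymMonData C] [SymMonData D] (h : SymMonFunctor H) (k : SymMonFunctor K) where
  trans : TrTrans H K
  modPi (a b : C) :
    TrTrans.at trans a ⊠₁ TrTrans.at trans b ≫ k.χ.at a b ≅
      h.χ.at a b ≫ TrTrans.at trans (a ⊠ b)
  modPi_mod : IsModification
    ((Cells.transC trans (p₁ C) ⊠c Cells.transC trans (p₂ C)) ⋙c Cells.chiC k.χ (p₁ C) (p₂ C))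
    (Cells.chiC h.χ (p₁ C) (p₂ C) ⋙c Cells.transC trans (p₁ C ⊠q p₂ C))
    (fun x => (modPi x.1 x.2).hom)
  modM : k.ι.hom ≅ h.ι.hom ≫ TrTrans.at trans (tUnit C)
  /-- Compatibility with the associators. -/
  associativity (a b c : C) :
    𝟙 ((TrTrans.at trans a ⊠₁ TrTrans.at trans b) ⊠₁ TrTrans.at trans c ≫
        k.χ.at a b ▹ K.obj c ≫ k.χ.at (a ⊠ b) c ≫ K.map (as a b c))
      ⊗≫ (sqR (modPi a b) (TrTrans.at trans c)).hom ▷ (k.χ.at (a ⊠ b) c ≫ K.map (as a b c))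
      ⊗≫ h.χ.at a b ▹ H.obj c ◁ (modPi (a ⊠ b) c).hom ▷ K.map (as a b c)
      ⊗≫ (h.χ.at a b ▹ H.obj c ≫ h.χ.at (a ⊠ b) c) ◁ TrTrans.nat trans (as a b c)
      ⊗≫ (h.modOmega a b c).hom ▷ TrTrans.at trans (a ⊠ b ⊠ c)
      ⊗≫ 𝟙 (as (H.obj a) (H.obj b) (H.obj c) ≫ H.obj a ◃ h.χ.at b c ≫ h.χ.at a (b ⊠ c) ≫
        TrTrans.at trans (a ⊠ b ⊠ c))
    = 𝟙 ((TrTrans.at trans a ⊠₁ TrTrans.at trans b) ⊠₁ TrTrans.at trans c ≫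
        k.χ.at a b ▹ K.obj c ≫ k.χ.at (a ⊠ b) c ≫ K.map (as a b c))
      ⊗≫ ((TrTrans.at trans a ⊠₁ TrTrans.at trans b) ⊠₁ TrTrans.at trans c) ◁ (k.modOmega a b c).hom
      ⊗≫ (asNat (TrTrans.at trans a) (TrTrans.at trans b) (TrTrans.at trans c)).hom ▷
        (K.obj a ◃ k.χ.at b c ≫ k.χ.at a (b ⊠ c))
      ⊗≫ as (H.obj a) (H.obj b) (H.obj c) ◁ (sqL (TrTrans.at trans a) (modPi b c)).hom ▷
        k.χ.at a (b ⊠ c)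
      ⊗≫ (as (H.obj a) (H.obj b) (H.obj c) ≫ H.obj a ◃ h.χ.at b c) ◁ (modPi a (b ⊠ c)).hom
      ⊗≫ 𝟙 (as (H.obj a) (H.obj b) (H.obj c) ≫ H.obj a ◃ h.χ.at b c ≫ h.χ.at a (b ⊠ c) ≫
        TrTrans.at trans (a ⊠ b ⊠ c))
  /-- Compatibility with the left unitors. -/
  left_unitality (a : C) :
    𝟙 (h.ι.hom ▹ H.obj a ≫ TrTrans.at trans (tUnit C) ⊠₁ TrTrans.at trans a ≫
        k.χ.at (tUnit C) a ≫ K.map (lu a))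
      ⊗≫ h.ι.hom ▹ H.obj a ◁ (modPi (tUnit C) a).hom ▷ K.map (lu a)
      ⊗≫ (h.ι.hom ▹ H.obj a ≫ h.χ.at (tUnit C) a) ◁ TrTrans.nat trans (lu a)
      ⊗≫ (h.modGamma a).hom ▷ TrTrans.at trans a
      ⊗≫ 𝟙 (lu (H.obj a) ≫ TrTrans.at trans a)
    = 𝟙 (h.ι.hom ▹ H.obj a ≫ TrTrans.at trans (tUnit C) ⊠₁ TrTrans.at trans a ≫
        k.χ.at (tUnit C) a ≫ K.map (lu a))
      ⊗≫ (triR modM (TrTrans.at trans a)).hom ▷ (k.χ.at (tUnit C) a ≫ K.map (lu a))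
      ⊗≫ tUnit D ◃ TrTrans.at trans a ◁ (k.modGamma a).hom
      ⊗≫ (luNat (TrTrans.at trans a)).hom
      ⊗≫ 𝟙 (lu (H.obj a) ≫ TrTrans.at trans a)
  /-- Compatibility with the right unitors. -/
  right_unitality (a : C) :
    𝟙 (TrTrans.at trans a ≫ K.map (ru a))
      ⊗≫ TrTrans.nat trans (ru a)
      ⊗≫ (h.modDelta a).hom ▷ TrTrans.at trans (a ⊠ tUnit C)
      ⊗≫ 𝟙 (ru (H.obj a) ≫ H.obj a ◃ h.ι.hom ≫ h.χ.at a (tUnit C) ≫ TrTrans.at trans (a ⊠ tUnit C))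
    = 𝟙 (TrTrans.at trans a ≫ K.map (ru a))
      ⊗≫ TrTrans.at trans a ◁ (k.modDelta a).hom
      ⊗≫ (ruNat (TrTrans.at trans a)).hom ▷ (K.obj a ◃ k.ι.hom ≫ k.χ.at a (tUnit C))
      ⊗≫ ru (H.obj a) ◁ (triL (TrTrans.at trans a) modM).hom ▷ k.χ.at a (tUnit C)
      ⊗≫ (ru (H.obj a) ≫ H.obj a ◃ h.ι.hom) ◁ (modPi a (tUnit C)).hom
      ⊗≫ 𝟙 (ru (H.obj a) ≫ H.obj a ◃ h.ι.hom ≫ h.χ.at a (tUnit C) ≫ TrTrans.at trans (a ⊠ tUnit C))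
  /-- Compatibility with the braidings. -/
  symmetry (a b : C) :
    𝟙 (TrTrans.at trans a ⊠₁ TrTrans.at trans b ≫ k.χ.at a b ≫ K.map (br a b))
      ⊗≫ (modPi a b).hom ▷ K.map (br a b)
      ⊗≫ h.χ.at a b ◁ TrTrans.nat trans (br a b)
      ⊗≫ (h.modUpsilon a b).hom ▷ TrTrans.at trans (b ⊠ a)
      ⊗≫ 𝟙 (br (H.obj a) (H.obj b) ≫ h.χ.at b a ≫ TrTrans.at trans (b ⊠ a))
    = 𝟙 (TrTrans.at trans a ⊠₁ TrTrans.at trans b ≫ k.χ.at a b ≫ K.map (br a b))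
      ⊗≫ (TrTrans.at trans a ⊠₁ TrTrans.at trans b) ◁ (k.modUpsilon a b).hom
      ⊗≫ (brNat (TrTrans.at trans a) (TrTrans.at trans b)).hom ▷ k.χ.at b a
      ⊗≫ br (H.obj a) (H.obj b) ◁ (modPi b a).hom
      ⊗≫ 𝟙 (br (H.obj a) (H.obj b) ≫ h.χ.at b a ≫ TrTrans.at trans (b ⊠ a))

end Transformations

/-! ### Anomalous quantum field theories -/

section Anomalous

variable {C : Type u₁} [Bicategory.{w₁, v₁} C] [SymMonData C]
  {D : Type u₂} [Bicategory.{w₂, v₂} D] [SymMonData D]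

/-- Symmetric monoidal structures on the trivial theory, which sends every object to the monoidal
unit, every 1-morphism to its identity 1-morphism and every 2-morphism to the identity
2-morphism. -/
abbrev TrivialTheory (C : Type u₁) [Bicategory.{w₁, v₁} C] [SymMonData C]
    (D : Type u₂) [Bicategory.{w₂, v₂} D] [SymMonData D] :=
  SymMonFunctor (constP C (tUnit D))

namespace TrivialTheory

variable (T : TrivialTheory C D)

/-- The 1-morphism `1 ⊗ 1 ⟶ 1` of the trivial theory. -/
def chi (a b : C) : tUnit D ⊠ tUnit D ⟶ tUnit D := T.χ.at a b

/-- The 1-morphism `1 ⟶ 1` of the trivial theory. -/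
def iota : tUnit D ⟶ tUnit D := T.ι.hom

/-- Naturality of `chi`. -/
def chiNat {a a' b b' : C} (f : a ⟶ a') (g : b ⟶ b') : T.chi a' b' ≅ T.chi a b :=
  (λ_ _).symm ≪≫ (tId (tUnit D) (tUnit D)).symm ▷ᵢ T.chi a' b' ≪≫ T.χ.nat f g ≪≫ ρ_ (T.chi a b)

/-- The modification `modOmega` of the trivial theory. -/
def omega (a b c : C) : T.chi a b ▹ tUnit D ≫ T.chi (a ⊠ b) c ≅
    as (tUnit D) (tUnit D) (tUnit D) ≫ tUnit D ◃ T.chi b c ≫ T.chi a (b ⊠ c) :=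
  T.chi a b ▹ tUnit D ◁ᵢ (ρ_ (T.chi (a ⊠ b) c)).symm ≪≫ T.modOmega a b c

/-- The modification `modGamma` of the trivial theory. -/
def gamma (a : C) : T.iota ▹ tUnit D ≫ T.chi (tUnit C) a ≅ lu (tUnit D) :=
  T.iota ▹ tUnit D ◁ᵢ (ρ_ (T.chi (tUnit C) a)).symm ≪≫ T.modGamma a

/-- The modification `modDelta` of the trivial theory. -/
def delta (a : C) : 𝟙 (tUnit D) ≅ ru (tUnit D) ≫ tUnit D ◃ T.iota ≫ T.chi a (tUnit C) :=
  T.modDelta a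

/-- The modification `modUpsilon` of the trivial theory. -/
def upsilon (a b : C) : T.chi a b ≅ br (tUnit D) (tUnit D) ≫ T.chi b a :=
  (ρ_ (T.chi a b)).symm ≪≫ T.modUpsilon a b

end TrivialTheory

/-- Anomalous quantum field theories with anomaly `K`: natural symmetric monoidal
2-transformations from the trivial theory to the truncation of `K`. -/
abbrev AnomalousTheory (T : TrivialTheory C D) {K : C ⥤ᵖ D} (k : SymMonFunctor K) :=
  TrSymMonTrans T k

namespace AnomalousTheory

variable {T : TrivialTheory C D} {K : C ⥤ᵖ D} {k : SymMonFunctor K} (A : AnomalousTheory T k)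

/-- The 1-morphism assigned to an object. -/
def onObj (a : C) : tUnit D ⟶ K.obj a := TrTrans.at A.trans a

/-- The naturality 2-morphism of a 1-morphism. -/
def natHom {a b : C} (f : a ⟶ b) : A.onObj a ≫ K.map f ⟶ 𝟙 (tUnit D) ≫ A.onObj b :=
  TrTrans.nat A.trans f

/-- The 2-morphism assigned to a 1-morphism. -/
def onHom {a b : C} (f : a ⟶ b) : A.onObj a ≫ K.map f ⟶ A.onObj b :=
  A.natHom f ≫ (λ_ (A.onObj b)).hom

/-- The modification relating the values on a tensor product to those on its factors. -/
def cellPi (a b : C) : A.onObj a ⊠₁ A.onObj b ≫ k.χ.at a b ≅ T.chi a b ≫ A.onObj (a ⊠ b) :=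
  A.modPi a b

/-- The modification relating the value on the monoidal unit to the unit of `K`. -/
def cellM : k.ι.hom ≅ T.iota ≫ A.onObj (tUnit C) := A.modM

end AnomalousTheory

end Anomalous

end AnomalousQFT

open AnomalousQFT

/-! The statement is what the definition of a natural symmetric monoidal 2-transformation becomes
when its source is constant. The naturality cell of `A` at `f : a ⟶ b` is `natHom f : A(a) ≫ K(f) ⟶
𝟙 ≫ A(b)`, and `onHom f` removes the leftover identity by a left unitor. Every law then comes from
one axiom in which the cells of the source theory have turned into identities and unitors.

The composition, unit and invariance laws are the three axioms of a lax transformation on the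
truncation (`TrTrans.nat_comp`, `TrTrans.nat_id`, `TrTrans.nat_naturality`). The law for tensor
products of 1-morphisms is the modification axiom `modPi_mod`. The laws for associators, unitors and
braidings are the compatibility axioms of `A` with `modOmega`, `modGamma`, `modDelta` and
`modUpsilon`.

What remains is to match identity 1-morphisms: the unitor inside `onHom` against those inside
`omega`, `gamma`, `upsilon` and `chiNat`. With the constant values written as literal identities,
this is coherence in the bicategory `D`, which `bicategory` decides.

The tensor law `onHom_tensor` needs more. The 1-morphism `𝟙 ⊠₁ 𝟙` is not an identity; it is only
isomorphic to one, by the unit constraint `tId` of the tensor product. Removing it takes the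
compatibility of the tensor pseudofunctor with left unitors (`tHom₂_leftUnitor`), one interchange of
2-cells, and the cancellation of `tId` with its inverse. -/

namespace AnomalousQFT

/-! ### Axioms of a lax transformation between truncated 2-functors, expressed in the original
bicategory. -/

section TransLaws

variable {C : Type u₁} [Bicategory.{w₁, v₁} C] {D : Type u₂} [Bicategory.{w₂, v₂} D]
  {H K : C ⥤ᵖ D} (θ : TrTrans H K)

/-- The 2-morphisms of the pith are the isomorphisms of `C`, so the axiom can be evaluated only at
an invertible `φ`, packaged as `CoreHom.mk φ`. -/
theorem TrTrans.nat_naturality {a b : C} {f g : a ⟶ b} (φ : f ≅ g) :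
    TrTrans.nat θ f ≫ H.map₂ φ.hom ▷ TrTrans.at θ b =
      TrTrans.at θ a ◁ K.map₂ φ.hom ≫ TrTrans.nat θ g :=
  θ.naturality_naturality (a := ⟨a⟩) (b := ⟨b⟩) (f := ⟨f⟩) (g := ⟨g⟩) (CoreHom.mk φ)

theorem TrTrans.nat_id (a : C) :
    TrTrans.at θ a ◁ (K.mapId a).inv ≫ TrTrans.nat θ (𝟙 a) =
      (ρ_ _).hom ≫ (λ_ _).inv ≫ (H.mapId a).inv ▷ TrTrans.at θ a := by
  have h := θ.naturality_id (⟨a⟩ : Pith C)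
  -- The unit constraint of the composite `trunc K` is that of `K` followed by `K.map₂` of the unit
  -- constraint of the inclusion, which is an identity. The inverse appears because a lax constraint
  -- points from `𝟙` to `K(𝟙)`.
  have hK : (trunc K).toLax.mapId (⟨a⟩ : Pith C) = (K.mapId a).inv :=
    (congrArg (_ ≫ ·) (K.map₂_id _)).trans (Category.comp_id _)
  have hH : (trunc H).toLax.mapId (⟨a⟩ : Pith C) = (H.mapId a).inv :=
    (congrArg (_ ≫ ·) (H.map₂_id _)).trans (Category.comp_id _)
  rw [hK, hH] at h
  exact h

theorem TrTrans.nat_comp {a b c : C} (f : a ⟶ b) (g : b ⟶ c) :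
    TrTrans.at θ a ◁ (K.mapComp f g).inv ≫ TrTrans.nat θ (f ≫ g) =
      (α_ _ _ _).inv ≫ TrTrans.nat θ f ▷ K.map g ≫ (α_ _ _ _).hom ≫
        H.map f ◁ TrTrans.nat θ g ≫ (α_ _ _ _).inv ≫ (H.mapComp f g).inv ▷ TrTrans.at θ c := by
  have h := θ.naturality_comp (a := (⟨a⟩ : Pith C)) (b := ⟨b⟩) (c := ⟨c⟩) ⟨f⟩ ⟨g⟩
  -- As for the unit constraint, the inclusion contributes only an identity factor.
  have hK : (trunc K).toLax.mapComp (a := (⟨a⟩ : Pith C)) (b := ⟨b⟩) (c := ⟨c⟩) ⟨f⟩ ⟨g⟩ =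
      (K.mapComp f g).inv :=
    (congrArg (_ ≫ ·) (K.map₂_id _)).trans (Category.comp_id _)
  have hH : (trunc H).toLax.mapComp (a := (⟨a⟩ : Pith C)) (b := ⟨b⟩) (c := ⟨c⟩) ⟨f⟩ ⟨g⟩ =
      (H.mapComp f g).inv :=
    (congrArg (_ ≫ ·) (H.map₂_id _)).trans (Category.comp_id _)
  rw [hK, hH] at h
  exact h

end TransLaws

/-! ### Functoriality of the tensor product on 2-morphisms. -/

section TensorLaws

variable {B : Type u} [Bicategory.{w, v} B] [TensorBicategory B] {a a' b b' : B}

theorem tHom₂_comp {f f' f'' : a ⟶ a'} {g g' g'' : b ⟶ b'} (η : f ⟶ f') (η' : f' ⟶ f'')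
    (θ : g ⟶ g') (θ' : g' ⟶ g'') :
    tHom₂ (η ≫ η') (θ ≫ θ') = tHom₂ η θ ≫ tHom₂ η' θ' :=
  TensorBicategory.tensor.map₂_comp (a := (a, b)) (b := (a', b')) (f := (f, g)) (g := (f', g'))
    (h := (f'', g'')) (η, θ) (η', θ')

/-- Used to treat `A(f) ⊗ A(g)`: its two left unitors become a single left unitor of `D` at the cost
of `tComp` and `tId`. -/
theorem tHom₂_leftUnitor (f : a ⟶ a') (g : b ⟶ b') :
    tHom₂ (λ_ f).hom (λ_ g).hom =
      (tComp (𝟙 a) f (𝟙 b) g).hom ≫ (tId a b).hom ▷ (f ⊠₁ g) ≫ (λ_ (f ⊠₁ g)).hom :=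
  TensorBicategory.tensor.map₂_left_unitor (a := (a, b)) (b := (a', b')) (f, g)

end TensorLaws

/-! ### Composition, unit and invariance laws. -/

namespace AnomalousTheory

variable {C : Type u₁} [Bicategory.{w₁, v₁} C] [SymMonData C]
  {D : Type u₂} [Bicategory.{w₂, v₂} D] [SymMonData D]
  {T : TrivialTheory C D} {K : C ⥤ᵖ D} {k : SymMonFunctor K} (A : AnomalousTheory T k)

theorem natHom_naturality {a b : C} {f g : a ⟶ b} (φ : f ≅ g) :
    A.natHom f = A.onObj a ◁ K.map₂ φ.hom ≫ A.natHom g := by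
  -- The constant theory sends `φ` to an identity 2-morphism, so the source side of the naturality
  -- square disappears.
  have h : A.natHom f ≫ 𝟙 (𝟙 (tUnit D)) ▷ A.onObj b = A.onObj a ◁ K.map₂ φ.hom ≫ A.natHom g :=
    TrTrans.nat_naturality A.trans φ
  simpa using h

theorem natHom_id (a : C) :
    A.onObj a ◁ (K.mapId a).inv ≫ A.natHom (𝟙 a) = (ρ_ (A.onObj a)).hom ≫ (λ_ (A.onObj a)).inv := by
  have h : A.onObj a ◁ (K.mapId a).inv ≫ A.natHom (𝟙 a) =
      (ρ_ (A.onObj a)).hom ≫ (λ_ (A.onObj a)).inv ≫ 𝟙 (𝟙 (tUnit D)) ▷ A.onObj a :=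
    TrTrans.nat_id A.trans a
  simpa using h

/-- The last factor is the composition constraint of the constant theory: `constP` has `mapComp`
equal to `(λ_ (𝟙 b)).symm`, and its inverse is a left unitor. -/
theorem natHom_comp {a b c : C} (f : a ⟶ b) (g : b ⟶ c) :
    A.onObj a ◁ (K.mapComp f g).inv ≫ A.natHom (f ≫ g) =
      (α_ _ _ _).inv ≫ A.natHom f ▷ K.map g ≫ (α_ _ _ _).hom ≫
        𝟙 (tUnit D) ◁ A.natHom g ≫ (α_ _ _ _).inv ≫ (λ_ (𝟙 (tUnit D))).hom ▷ A.onObj c :=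
  TrTrans.nat_comp A.trans f g

/-- Here `(K.mapComp f g).inv` is the constraint `Φ` of the projective composition law. After
`natHom_comp`, both sides paste `natHom f` and `natHom g` and differ by unitors and associators;
naturality of the left unitor removes the whiskering of `natHom g` by `𝟙`. -/
theorem onHom_comp {a b c : C} (f : a ⟶ b) (g : b ⟶ c) :
    A.onHom f ▷ K.map g ≫ A.onHom g =
      (α_ (A.onObj a) (K.map f) (K.map g)).hom ≫ A.onObj a ◁ (K.mapComp f g).inv ≫
        A.onHom (f ≫ g) := by
  have h := A.natHom_comp f g
  simp only [onHom, reassoc_of% h]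
  bicategory

theorem onHom_id (a : C) :
    A.onObj a ◁ (K.mapId a).inv ≫ A.onHom (𝟙 a) = (ρ_ (A.onObj a)).hom := by
  have h := A.natHom_id a
  simp [onHom, reassoc_of% h]

theorem onHom_naturality {a b : C} {f g : a ⟶ b} (φ : f ≅ g) :
    A.onHom f = A.onObj a ◁ K.map₂ φ.hom ≫ A.onHom g := by
  simp only [onHom, A.natHom_naturality φ, Category.assoc]

/-! ### Compatibility with the symmetric monoidal structure. -/

/-- This is the axiom `A.associativity` with one identity 1-morphism moved: the left unitor in
`onHom` and the inverse right unitor in `omega` both remove the `𝟙` which is the value of the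
trivial theory on the associator. The triangle identity makes them cancel. -/
theorem onHom_associator (a b c : C) :
      𝟙 ((A.onObj a ⊠₁ A.onObj b) ⊠₁ A.onObj c ≫ k.χ.at a b ▹ K.obj c ≫ k.χ.at (a ⊠ b) c ≫
          K.map (as a b c))
        ⊗≫ (sqR (A.cellPi a b) (A.onObj c)).hom ▷ (k.χ.at (a ⊠ b) c ≫ K.map (as a b c))
        ⊗≫ T.chi a b ▹ tUnit D ◁ (A.cellPi (a ⊠ b) c).hom ▷ K.map (as a b c)
        ⊗≫ (T.chi a b ▹ tUnit D ≫ T.chi (a ⊠ b) c) ◁ A.onHom (as a b c)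
        ⊗≫ (T.omega a b c).hom ▷ A.onObj (a ⊠ b ⊠ c)
        ⊗≫ 𝟙 (as (tUnit D) (tUnit D) (tUnit D) ≫ tUnit D ◃ T.chi b c ≫ T.chi a (b ⊠ c) ≫
          A.onObj (a ⊠ b ⊠ c))
      = 𝟙 ((A.onObj a ⊠₁ A.onObj b) ⊠₁ A.onObj c ≫ k.χ.at a b ▹ K.obj c ≫ k.χ.at (a ⊠ b) c ≫
          K.map (as a b c))
        ⊗≫ ((A.onObj a ⊠₁ A.onObj b) ⊠₁ A.onObj c) ◁ (k.modOmega a b c).hom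
        ⊗≫ (asNat (A.onObj a) (A.onObj b) (A.onObj c)).hom ▷
          (K.obj a ◃ k.χ.at b c ≫ k.χ.at a (b ⊠ c))
        ⊗≫ as (tUnit D) (tUnit D) (tUnit D) ◁ (sqL (A.onObj a) (A.cellPi b c)).hom ▷
          k.χ.at a (b ⊠ c)
        ⊗≫ (as (tUnit D) (tUnit D) (tUnit D) ≫ tUnit D ◃ T.chi b c) ◁ (A.cellPi a (b ⊠ c)).hom
        ⊗≫ 𝟙 (as (tUnit D) (tUnit D) (tUnit D) ≫ tUnit D ◃ T.chi b c ≫ T.chi a (b ⊠ c) ≫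
          A.onObj (a ⊠ b ⊠ c)) := by
  -- The type ascription replaces the value of `constP` on the associator by the definitionally
  -- equal `𝟙 (tUnit D)`, so that coherence recognises it as an identity. The intermediate
  -- expression below is then the left side of `A.associativity` by definitional unfolding.
  let ω : T.chi a b ▹ tUnit D ≫ T.chi (a ⊠ b) c ≫ 𝟙 (tUnit D) ≅
    as (tUnit D) (tUnit D) (tUnit D) ≫ tUnit D ◃ T.chi b c ≫ T.chi a (b ⊠ c) := T.modOmega a b c
  refine Eq.trans (b :=
      𝟙 ((A.onObj a ⊠₁ A.onObj b) ⊠₁ A.onObj c ≫ k.χ.at a b ▹ K.obj c ≫ k.χ.at (a ⊠ b) c ≫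
          K.map (as a b c))
        ⊗≫ (sqR (A.cellPi a b) (A.onObj c)).hom ▷ (k.χ.at (a ⊠ b) c ≫ K.map (as a b c))
        ⊗≫ T.chi a b ▹ tUnit D ◁ (A.cellPi (a ⊠ b) c).hom ▷ K.map (as a b c)
        ⊗≫ (T.chi a b ▹ tUnit D ≫ T.chi (a ⊠ b) c) ◁ A.natHom (as a b c)
        ⊗≫ ω.hom ▷ A.onObj (a ⊠ b ⊠ c)
        ⊗≫ 𝟙 (as (tUnit D) (tUnit D) (tUnit D) ≫ tUnit D ◃ T.chi b c ≫ T.chi a (b ⊠ c) ≫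
          A.onObj (a ⊠ b ⊠ c))) ?_ (A.associativity a b c)
  have hω : (T.omega a b c).hom = T.chi a b ▹ tUnit D ◁ (ρ_ (T.chi (a ⊠ b) c)).inv ≫ ω.hom := rfl
  rw [hω, onHom]
  bicategory

/-- The modification axiom of `modPi` at `(f, g)` has the inverse of the naturality cell `ν` of `χ`
on its left side and `Π` whiskered by `𝟙 ⊠₁ 𝟙` on its right side. Pasting `ν` onto both sides
cancels it on the left. On the right, `tHom₂_leftUnitor` supplies `tId` before `Π` and `chiNat`
supplies its inverse after `Π`; interchange makes the two adjacent. -/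
theorem onHom_tensor {a a' b b' : C} (f : a ⟶ a') (g : b ⟶ b') :
    𝟙 (A.onObj a ⊠₁ A.onObj b ≫ k.χ.at a b ≫ K.map (f ⊠₁ g))
        ⊗≫ (A.cellPi a b).hom ▷ K.map (f ⊠₁ g)
        ⊗≫ T.chi a b ◁ A.onHom (f ⊠₁ g)
        ⊗≫ 𝟙 (T.chi a b ≫ A.onObj (a' ⊠ b'))
      = 𝟙 (A.onObj a ⊠₁ A.onObj b ≫ k.χ.at a b ≫ K.map (f ⊠₁ g))
        ⊗≫ (A.onObj a ⊠₁ A.onObj b) ◁ (k.χ.nat f g).inv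
        ⊗≫ ((tComp (A.onObj a) (K.map f) (A.onObj b) (K.map g)).inv ≫
          tHom₂ (A.onHom f) (A.onHom g)) ▷ k.χ.at a' b'
        ⊗≫ (A.cellPi a' b').hom
        ⊗≫ (T.chiNat f g).hom ▷ A.onObj (a' ⊠ b')
        ⊗≫ 𝟙 (T.chi a b ≫ A.onObj (a' ⊠ b')) := by
  let ν : 𝟙 (tUnit D) ⊠₁ 𝟙 (tUnit D) ≫ T.chi a' b' ≅ T.chi a b ≫ 𝟙 (tUnit D) := T.χ.nat f g
  -- The axiom `modPi_mod` with `Cells.comp`, `Cells.tens` and `Cells.chiC` unfolded and the values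
  -- of the constant theory written as identities.
  have h : (A.cellPi a b).hom ▷ K.map (f ⊠₁ g) ≫
        ((α_ _ _ _).hom ≫ T.chi a b ◁ A.natHom (f ⊠₁ g) ≫ (α_ _ _ _).inv ≫
          ν.inv ▷ A.onObj (a' ⊠ b') ≫ (α_ _ _ _).hom) =
      ((α_ _ _ _).hom ≫ (A.onObj a ⊠₁ A.onObj b) ◁ (k.χ.nat f g).inv ≫ (α_ _ _ _).inv ≫
        ((tComp (A.onObj a) (K.map f) (A.onObj b) (K.map g)).inv ≫
          tHom₂ (A.natHom f) (A.natHom g) ≫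
            (tComp (𝟙 (tUnit D)) (A.onObj a') (𝟙 (tUnit D)) (A.onObj b')).hom) ▷ k.χ.at a' b' ≫
          (α_ _ _ _).hom) ≫ (𝟙 (tUnit D) ⊠₁ 𝟙 (tUnit D)) ◁ (A.cellPi a' b').hom :=
    A.modPi_mod (x := (a, b)) (y := (a', b')) (f, g)
  have hν : (T.chiNat f g).hom = (λ_ _).inv ≫ (tId (tUnit D) (tUnit D)).inv ▷ T.chi a' b' ≫
      ν.hom ≫ (ρ_ (T.chi a b)).hom := rfl
  have hlhs : 𝟙 (A.onObj a ⊠₁ A.onObj b ≫ k.χ.at a b ≫ K.map (f ⊠₁ g))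
        ⊗≫ (A.cellPi a b).hom ▷ K.map (f ⊠₁ g)
        ⊗≫ T.chi a b ◁ A.onHom (f ⊠₁ g)
        ⊗≫ 𝟙 (T.chi a b ≫ A.onObj (a' ⊠ b')) =
      𝟙 _ ⊗≫ ((A.cellPi a b).hom ▷ K.map (f ⊠₁ g) ≫
        ((α_ _ _ _).hom ≫ T.chi a b ◁ A.natHom (f ⊠₁ g) ≫ (α_ _ _ _).inv ≫
          ν.inv ▷ A.onObj (a' ⊠ b') ≫ (α_ _ _ _).hom)) ⊗≫ ν.hom ▷ A.onObj (a' ⊠ b')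
        ⊗≫ 𝟙 (T.chi a b ≫ A.onObj (a' ⊠ b')) := by
    -- Coherence only gathers `ν.inv` and `ν.hom` under one whiskering. Their cancellation is a
    -- property of `ν`, which is not a coherence cell, and is applied separately.
    have hc : 𝟙 (A.onObj a ⊠₁ A.onObj b ≫ k.χ.at a b ≫ K.map (f ⊠₁ g))
        ⊗≫ (A.cellPi a b).hom ▷ K.map (f ⊠₁ g)
        ⊗≫ T.chi a b ◁ A.natHom (f ⊠₁ g) ⊗≫ (ν.inv ≫ ν.hom) ▷ A.onObj (a' ⊠ b')
        ⊗≫ 𝟙 (T.chi a b ≫ A.onObj (a' ⊠ b')) =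
      𝟙 _ ⊗≫ ((A.cellPi a b).hom ▷ K.map (f ⊠₁ g) ≫
        ((α_ _ _ _).hom ≫ T.chi a b ◁ A.natHom (f ⊠₁ g) ≫ (α_ _ _ _).inv ≫
          ν.inv ▷ A.onObj (a' ⊠ b') ≫ (α_ _ _ _).hom)) ⊗≫ ν.hom ▷ A.onObj (a' ⊠ b')
        ⊗≫ 𝟙 (T.chi a b ≫ A.onObj (a' ⊠ b')) := by bicategory
    rw [← hc, ν.inv_hom_id, onHom]
    bicategory
  -- The right side of the law with `onHom` and `chiNat` expanded. The product `tId.hom ▷ _ ≫ 𝟙 ◁ Π`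
  -- is bracketed to have the shape of the interchange law.
  have hrhs : 𝟙 (A.onObj a ⊠₁ A.onObj b ≫ k.χ.at a b ≫ K.map (f ⊠₁ g))
        ⊗≫ (A.onObj a ⊠₁ A.onObj b) ◁ (k.χ.nat f g).inv
        ⊗≫ ((tComp (A.onObj a) (K.map f) (A.onObj b) (K.map g)).inv ≫
          tHom₂ (A.natHom f) (A.natHom g) ≫
            (tComp (𝟙 (tUnit D)) (A.onObj a') (𝟙 (tUnit D)) (A.onObj b')).hom) ▷ k.χ.at a' b'
        ⊗≫ ((tId (tUnit D) (tUnit D)).hom ▷ (A.onObj a' ⊠₁ A.onObj b' ≫ k.χ.at a' b') ≫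
          𝟙 (tUnit D ⊠ tUnit D) ◁ (A.cellPi a' b').hom)
        ⊗≫ (tId (tUnit D) (tUnit D)).inv ▷ (T.chi a' b' ≫ A.onObj (a' ⊠ b'))
        ⊗≫ ν.hom ▷ A.onObj (a' ⊠ b')
        ⊗≫ 𝟙 (T.chi a b ≫ A.onObj (a' ⊠ b')) =
      𝟙 (A.onObj a ⊠₁ A.onObj b ≫ k.χ.at a b ≫ K.map (f ⊠₁ g))
        ⊗≫ (A.onObj a ⊠₁ A.onObj b) ◁ (k.χ.nat f g).inv
        ⊗≫ ((tComp (A.onObj a) (K.map f) (A.onObj b) (K.map g)).inv ≫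
          tHom₂ (A.onHom f) (A.onHom g)) ▷ k.χ.at a' b'
        ⊗≫ (A.cellPi a' b').hom
        ⊗≫ (T.chiNat f g).hom ▷ A.onObj (a' ⊠ b')
        ⊗≫ 𝟙 (T.chi a b ≫ A.onObj (a' ⊠ b')) := by
    rw [hν, onHom, onHom, tHom₂_comp, tHom₂_leftUnitor]
    bicategory
  -- Interchange carries `tId.hom` past `Π`, after which `Π` is whiskered by `𝟙 ⊠₁ 𝟙`, as in `h`.
  rw [hlhs, h, ← hrhs, ← whisker_exchange]
  -- With `tId.hom` and `tId.inv` now adjacent, they are placed under a common whiskering and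
  -- cancelled.
  have hc : 𝟙 (A.onObj a ⊠₁ A.onObj b ≫ k.χ.at a b ≫ K.map (f ⊠₁ g))
        ⊗≫ (A.onObj a ⊠₁ A.onObj b) ◁ (k.χ.nat f g).inv
        ⊗≫ ((tComp (A.onObj a) (K.map f) (A.onObj b) (K.map g)).inv ≫
          tHom₂ (A.natHom f) (A.natHom g) ≫
            (tComp (𝟙 (tUnit D)) (A.onObj a') (𝟙 (tUnit D)) (A.onObj b')).hom) ▷ k.χ.at a' b'
        ⊗≫ ((𝟙 (tUnit D) ⊠₁ 𝟙 (tUnit D)) ◁ (A.cellPi a' b').hom ≫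
          (tId (tUnit D) (tUnit D)).hom ▷ (T.chi a' b' ≫ A.onObj (a' ⊠ b')))
        ⊗≫ (tId (tUnit D) (tUnit D)).inv ▷ (T.chi a' b' ≫ A.onObj (a' ⊠ b'))
        ⊗≫ ν.hom ▷ A.onObj (a' ⊠ b')
        ⊗≫ 𝟙 (T.chi a b ≫ A.onObj (a' ⊠ b')) =
      𝟙 (A.onObj a ⊠₁ A.onObj b ≫ k.χ.at a b ≫ K.map (f ⊠₁ g))
        ⊗≫ (A.onObj a ⊠₁ A.onObj b) ◁ (k.χ.nat f g).inv
        ⊗≫ ((tComp (A.onObj a) (K.map f) (A.onObj b) (K.map g)).inv ≫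
          tHom₂ (A.natHom f) (A.natHom g) ≫
            (tComp (𝟙 (tUnit D)) (A.onObj a') (𝟙 (tUnit D)) (A.onObj b')).hom) ▷ k.χ.at a' b'
        ⊗≫ (𝟙 (tUnit D) ⊠₁ 𝟙 (tUnit D)) ◁ (A.cellPi a' b').hom
        ⊗≫ ((tId (tUnit D) (tUnit D)).hom ≫ (tId (tUnit D) (tUnit D)).inv) ▷
          (T.chi a' b' ≫ A.onObj (a' ⊠ b'))
        ⊗≫ ν.hom ▷ A.onObj (a' ⊠ b')
        ⊗≫ 𝟙 (T.chi a b ≫ A.onObj (a' ⊠ b')) := by bicategory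
  rw [hc, Iso.hom_inv_id]
  bicategory

/-- Same mechanism as for the associator: the unitors in `onHom` and `gamma` cancel, which leaves
`A.left_unitality`. -/
theorem onHom_leftUnitor (a : C) :
      𝟙 (T.iota ▹ tUnit D ≫ A.onObj (tUnit C) ⊠₁ A.onObj a ≫ k.χ.at (tUnit C) a ≫ K.map (lu a))
        ⊗≫ T.iota ▹ tUnit D ◁ (A.cellPi (tUnit C) a).hom ▷ K.map (lu a)
        ⊗≫ (T.iota ▹ tUnit D ≫ T.chi (tUnit C) a) ◁ A.onHom (lu a)
        ⊗≫ (T.gamma a).hom ▷ A.onObj a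
        ⊗≫ 𝟙 (lu (tUnit D) ≫ A.onObj a)
      = 𝟙 (T.iota ▹ tUnit D ≫ A.onObj (tUnit C) ⊠₁ A.onObj a ≫ k.χ.at (tUnit C) a ≫
          K.map (lu a))
        ⊗≫ (triR A.cellM (A.onObj a)).hom ▷ (k.χ.at (tUnit C) a ≫ K.map (lu a))
        ⊗≫ tUnit D ◃ A.onObj a ◁ (k.modGamma a).hom
        ⊗≫ (luNat (A.onObj a)).hom
        ⊗≫ 𝟙 (lu (tUnit D) ≫ A.onObj a) := by
  let γ : T.iota ▹ tUnit D ≫ T.chi (tUnit C) a ≫ 𝟙 (tUnit D) ≅ lu (tUnit D) := T.modGamma a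
  refine Eq.trans (b :=
      𝟙 (T.iota ▹ tUnit D ≫ A.onObj (tUnit C) ⊠₁ A.onObj a ≫ k.χ.at (tUnit C) a ≫ K.map (lu a))
        ⊗≫ T.iota ▹ tUnit D ◁ (A.cellPi (tUnit C) a).hom ▷ K.map (lu a)
        ⊗≫ (T.iota ▹ tUnit D ≫ T.chi (tUnit C) a) ◁ A.natHom (lu a)
        ⊗≫ γ.hom ▷ A.onObj a
        ⊗≫ 𝟙 (lu (tUnit D) ≫ A.onObj a)) ?_ (A.left_unitality a)
  have hγ : (T.gamma a).hom = T.iota ▹ tUnit D ◁ (ρ_ (T.chi (tUnit C) a)).inv ≫ γ.hom := rfl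
  rw [hγ, onHom]
  bicategory

/-- The source of `modDelta` for the trivial theory is the bare `𝟙`, with no factor to compose it
with, so `delta` carries no unitor correction. The left unitor in `onHom` cancels against the one
that `⊗≫` inserts before `delta`. -/
theorem onHom_rightUnitor (a : C) :
      𝟙 (A.onObj a ≫ K.map (ru a))
        ⊗≫ A.onHom (ru a)
        ⊗≫ (T.delta a).hom ▷ A.onObj (a ⊠ tUnit C)
        ⊗≫ 𝟙 (ru (tUnit D) ≫ tUnit D ◃ T.iota ≫ T.chi a (tUnit C) ≫ A.onObj (a ⊠ tUnit C))
      = 𝟙 (A.onObj a ≫ K.map (ru a))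
        ⊗≫ A.onObj a ◁ (k.modDelta a).hom
        ⊗≫ (ruNat (A.onObj a)).hom ▷ (K.obj a ◃ k.ι.hom ≫ k.χ.at a (tUnit C))
        ⊗≫ ru (tUnit D) ◁ (triL (A.onObj a) A.cellM).hom ▷ k.χ.at a (tUnit C)
        ⊗≫ (ru (tUnit D) ≫ tUnit D ◃ T.iota) ◁ (A.cellPi a (tUnit C)).hom
        ⊗≫ 𝟙 (ru (tUnit D) ≫ tUnit D ◃ T.iota ≫ T.chi a (tUnit C) ≫
          A.onObj (a ⊠ tUnit C)) := by
  -- The comparison cell after `natHom` is written out as a whiskered identity, the form it has in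
  -- `A.right_unitality` for a general source. With a literal `𝟙` in the source, `⊗≫` is free to
  -- choose unitors instead, and the match with the axiom has to be definitional.
  refine Eq.trans (b :=
      𝟙 (A.onObj a ≫ K.map (ru a))
        ⊗≫ (A.natHom (ru a) ≫ 𝟙 (𝟙 (tUnit D)) ▷ A.onObj (a ⊠ tUnit C) ≫
        ((T.delta a).hom ▷ A.onObj (a ⊠ tUnit C)
        ⊗≫ 𝟙 (ru (tUnit D) ≫ tUnit D ◃ T.iota ≫ T.chi a (tUnit C) ≫ A.onObj (a ⊠ tUnit C)))))
    ?_ (A.right_unitality a)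
  rw [onHom]
  bicategory

/-- Here the right unitor in `upsilon` plays the role that it has in `omega`, and the axiom is
`A.symmetry`. -/
theorem onHom_braiding (a b : C) :
      𝟙 (A.onObj a ⊠₁ A.onObj b ≫ k.χ.at a b ≫ K.map (br a b))
        ⊗≫ (A.cellPi a b).hom ▷ K.map (br a b)
        ⊗≫ T.chi a b ◁ A.onHom (br a b)
        ⊗≫ (T.upsilon a b).hom ▷ A.onObj (b ⊠ a)
        ⊗≫ 𝟙 (br (tUnit D) (tUnit D) ≫ T.chi b a ≫ A.onObj (b ⊠ a))
      = 𝟙 (A.onObj a ⊠₁ A.onObj b ≫ k.χ.at a b ≫ K.map (br a b))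
        ⊗≫ (A.onObj a ⊠₁ A.onObj b) ◁ (k.modUpsilon a b).hom
        ⊗≫ (brNat (A.onObj a) (A.onObj b)).hom ▷ k.χ.at b a
        ⊗≫ br (tUnit D) (tUnit D) ◁ (A.cellPi b a).hom
        ⊗≫ 𝟙 (br (tUnit D) (tUnit D) ≫ T.chi b a ≫ A.onObj (b ⊠ a)) := by
  let υ : T.chi a b ≫ 𝟙 (tUnit D) ≅ br (tUnit D) (tUnit D) ≫ T.chi b a := T.modUpsilon a b
  refine Eq.trans (b :=
      𝟙 (A.onObj a ⊠₁ A.onObj b ≫ k.χ.at a b ≫ K.map (br a b))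
        ⊗≫ (A.cellPi a b).hom ▷ K.map (br a b)
        ⊗≫ T.chi a b ◁ A.natHom (br a b)
        ⊗≫ υ.hom ▷ A.onObj (b ⊠ a)
        ⊗≫ 𝟙 (br (tUnit D) (tUnit D) ≫ T.chi b a ≫ A.onObj (b ⊠ a))) ?_ (A.symmetry a b)
  have hυ : (T.upsilon a b).hom = (ρ_ (T.chi a b)).inv ≫ υ.hom := rfl
  rw [hυ, onHom]
  bicategory

end AnomalousTheory

end AnomalousQFT

/-! ### The eight laws together. -/

theorem mainTheorem8
    {C : Type u₁} [Bicategory.{w₁, v₁} C] [SymMonBicategory C]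
    {D : Type u₂} [Bicategory.{w₂, v₂} D] [SymMonBicategory D]
    (T : TrivialTheory C D)
    (𝒜 : C ⥤ᵖ D) (k : SymMonFunctor 𝒜)
    (A : AnomalousTheory T k) :
    -- composition law
    (∀ {a b c : C} (f : a ⟶ b) (g : b ⟶ c),
      A.onHom f ▷ 𝒜.map g ≫ A.onHom g =
        (α_ (A.onObj a) (𝒜.map f) (𝒜.map g)).hom ≫ A.onObj a ◁ (𝒜.mapComp f g).inv ≫
          A.onHom (f ≫ g)) ∧
    -- unit law
    (∀ a : C,
      A.onObj a ◁ (𝒜.mapId a).inv ≫ A.onHom (𝟙 a) = (ρ_ (A.onObj a)).hom) ∧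
    -- invariance under 2-isomorphisms
    (∀ {a b : C} {f g : a ⟶ b} (φ : f ≅ g),
      A.onHom f = A.onObj a ◁ 𝒜.map₂ φ.hom ≫ A.onHom g) ∧
    -- tensor products of 1-morphisms
    (∀ {a a' b b' : C} (f : a ⟶ a') (g : b ⟶ b'),
      𝟙 (A.onObj a ⊠₁ A.onObj b ≫ k.χ.at a b ≫ 𝒜.map (f ⊠₁ g))
        ⊗≫ (A.cellPi a b).hom ▷ 𝒜.map (f ⊠₁ g)
        ⊗≫ T.chi a b ◁ A.onHom (f ⊠₁ g)
        ⊗≫ 𝟙 (T.chi a b ≫ A.onObj (a' ⊠ b'))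
      = 𝟙 (A.onObj a ⊠₁ A.onObj b ≫ k.χ.at a b ≫ 𝒜.map (f ⊠₁ g))
        ⊗≫ (A.onObj a ⊠₁ A.onObj b) ◁ (k.χ.nat f g).inv
        ⊗≫ ((tComp (A.onObj a) (𝒜.map f) (A.onObj b) (𝒜.map g)).inv ≫
          tHom₂ (A.onHom f) (A.onHom g)) ▷ k.χ.at a' b'
        ⊗≫ (A.cellPi a' b').hom
        ⊗≫ (T.chiNat f g).hom ▷ A.onObj (a' ⊠ b')
        ⊗≫ 𝟙 (T.chi a b ≫ A.onObj (a' ⊠ b'))) ∧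
    -- associators
    (∀ a b c : C,
      𝟙 ((A.onObj a ⊠₁ A.onObj b) ⊠₁ A.onObj c ≫ k.χ.at a b ▹ 𝒜.obj c ≫ k.χ.at (a ⊠ b) c ≫
          𝒜.map (as a b c))
        ⊗≫ (sqR (A.cellPi a b) (A.onObj c)).hom ▷ (k.χ.at (a ⊠ b) c ≫ 𝒜.map (as a b c))
        ⊗≫ T.chi a b ▹ tUnit D ◁ (A.cellPi (a ⊠ b) c).hom ▷ 𝒜.map (as a b c)
        ⊗≫ (T.chi a b ▹ tUnit D ≫ T.chi (a ⊠ b) c) ◁ A.onHom (as a b c)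
        ⊗≫ (T.omega a b c).hom ▷ A.onObj (a ⊠ b ⊠ c)
        ⊗≫ 𝟙 (as (tUnit D) (tUnit D) (tUnit D) ≫ tUnit D ◃ T.chi b c ≫ T.chi a (b ⊠ c) ≫
          A.onObj (a ⊠ b ⊠ c))
      = 𝟙 ((A.onObj a ⊠₁ A.onObj b) ⊠₁ A.onObj c ≫ k.χ.at a b ▹ 𝒜.obj c ≫ k.χ.at (a ⊠ b) c ≫
          𝒜.map (as a b c))
        ⊗≫ ((A.onObj a ⊠₁ A.onObj b) ⊠₁ A.onObj c) ◁ (k.modOmega a b c).hom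
        ⊗≫ (asNat (A.onObj a) (A.onObj b) (A.onObj c)).hom ▷
          (𝒜.obj a ◃ k.χ.at b c ≫ k.χ.at a (b ⊠ c))
        ⊗≫ as (tUnit D) (tUnit D) (tUnit D) ◁ (sqL (A.onObj a) (A.cellPi b c)).hom ▷
          k.χ.at a (b ⊠ c)
        ⊗≫ (as (tUnit D) (tUnit D) (tUnit D) ≫ tUnit D ◃ T.chi b c) ◁ (A.cellPi a (b ⊠ c)).hom
        ⊗≫ 𝟙 (as (tUnit D) (tUnit D) (tUnit D) ≫ tUnit D ◃ T.chi b c ≫ T.chi a (b ⊠ c) ≫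
          A.onObj (a ⊠ b ⊠ c))) ∧
    -- left unitors
    (∀ a : C,
      𝟙 (T.iota ▹ tUnit D ≫ A.onObj (tUnit C) ⊠₁ A.onObj a ≫ k.χ.at (tUnit C) a ≫ 𝒜.map (lu a))
        ⊗≫ T.iota ▹ tUnit D ◁ (A.cellPi (tUnit C) a).hom ▷ 𝒜.map (lu a)
        ⊗≫ (T.iota ▹ tUnit D ≫ T.chi (tUnit C) a) ◁ A.onHom (lu a)
        ⊗≫ (T.gamma a).hom ▷ A.onObj a
        ⊗≫ 𝟙 (lu (tUnit D) ≫ A.onObj a)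
      = 𝟙 (T.iota ▹ tUnit D ≫ A.onObj (tUnit C) ⊠₁ A.onObj a ≫ k.χ.at (tUnit C) a ≫
          𝒜.map (lu a))
        ⊗≫ (triR A.cellM (A.onObj a)).hom ▷ (k.χ.at (tUnit C) a ≫ 𝒜.map (lu a))
        ⊗≫ tUnit D ◃ A.onObj a ◁ (k.modGamma a).hom
        ⊗≫ (luNat (A.onObj a)).hom
        ⊗≫ 𝟙 (lu (tUnit D) ≫ A.onObj a)) ∧
    -- right unitors
    (∀ a : C,
      𝟙 (A.onObj a ≫ 𝒜.map (ru a))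
        ⊗≫ A.onHom (ru a)
        ⊗≫ (T.delta a).hom ▷ A.onObj (a ⊠ tUnit C)
        ⊗≫ 𝟙 (ru (tUnit D) ≫ tUnit D ◃ T.iota ≫ T.chi a (tUnit C) ≫ A.onObj (a ⊠ tUnit C))
      = 𝟙 (A.onObj a ≫ 𝒜.map (ru a))
        ⊗≫ A.onObj a ◁ (k.modDelta a).hom
        ⊗≫ (ruNat (A.onObj a)).hom ▷ (𝒜.obj a ◃ k.ι.hom ≫ k.χ.at a (tUnit C))
        ⊗≫ ru (tUnit D) ◁ (triL (A.onObj a) A.cellM).hom ▷ k.χ.at a (tUnit C)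
        ⊗≫ (ru (tUnit D) ≫ tUnit D ◃ T.iota) ◁ (A.cellPi a (tUnit C)).hom
        ⊗≫ 𝟙 (ru (tUnit D) ≫ tUnit D ◃ T.iota ≫ T.chi a (tUnit C) ≫
          A.onObj (a ⊠ tUnit C))) ∧
    -- braidings
    (∀ a b : C,
      𝟙 (A.onObj a ⊠₁ A.onObj b ≫ k.χ.at a b ≫ 𝒜.map (br a b))
        ⊗≫ (A.cellPi a b).hom ▷ 𝒜.map (br a b)
        ⊗≫ T.chi a b ◁ A.onHom (br a b)
        ⊗≫ (T.upsilon a b).hom ▷ A.onObj (b ⊠ a)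
        ⊗≫ 𝟙 (br (tUnit D) (tUnit D) ≫ T.chi b a ≫ A.onObj (b ⊠ a))
      = 𝟙 (A.onObj a ⊠₁ A.onObj b ≫ k.χ.at a b ≫ 𝒜.map (br a b))
        ⊗≫ (A.onObj a ⊠₁ A.onObj b) ◁ (k.modUpsilon a b).hom
        ⊗≫ (brNat (A.onObj a) (A.onObj b)).hom ▷ k.χ.at b a
        ⊗≫ br (tUnit D) (tUnit D) ◁ (A.cellPi b a).hom
        ⊗≫ 𝟙 (br (tUnit D) (tUnit D) ≫ T.chi b a ≫ A.onObj (b ⊠ a))) :=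
  ⟨fun f g => A.onHom_comp f g, A.onHom_id, fun φ => A.onHom_naturality φ,
    fun f g => A.onHom_tensor f g, A.onHom_associator, A.onHom_leftUnitor, A.onHom_rightUnitor,
    A.onHom_braiding⟩
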